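/- Let $\mathbb K$ be an algebraically closed field of characteristic zero, let $n,d\ge 4$, and let $$I=(x_0^d,\dots,x_n^d)+x_0^{d-1}(x_0,\dots,x_n)\subset \mathbb K[x_0,\dots,x_n],\qquad A=\mathbb K[x_0,\dots,x_n]/I .$$ Let polynomials act on polynomials as differential operators, $x_i$ acting as $\partial/\partial x_i$, and let $I^{-1}_d$ be the space of forms $F$ of degree $d$ with $\alpha(F)=0$ for all $\alpha\in I$. For a basis $F_1,\dots,F_N$ of $I^{-1}_d$ let $X_d\subset\mathbb P^{N-1}$ be the Zariski closure of the image of the rational map $\mathbb P^n\dashrightarrow\mathbb P^{N-1}$, $P\mapsto (F_1(P):\dots:F_N(P))$. The $s$-th osculating space $T^s_xX_d$ of $X_d$ at a smooth point $x$ is the linear subspace of $\mathbb P^{N-1}$ spanned by the values at $0$ of all partial derivatives of order $\le s$ of a local parametrization $\varphi$ of $X_d$ by power series in $\dim X_d$ variables with $\varphi(0)=x$. A variety $X$ of dimension $n$ satisfies exactly $\delta$ Laplace equations of order $s$ if $\dim T^s_xX=\binom{n+s}{s}-1-\delta$ at a generic smooth point $x\in X$. Then, for every choice of the basis, $X_d$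 has dimension $n$ and satisfies exactly one Laplace equation of order $d-1$, that is, $\dim T^{d-1}_xX_d=\binom{n+d-1}{d-1}-2$ for generic $x\in X_d$. Moreover, the kernel of the multiplication map $$\times(x_0+\dots+x_n)\colon A_{d-1}\to A_d$$ is one-dimensional, spanned by the class of $x_0^{d-1}$, which is nonzero. -/

import Mathlib

noncomputable section

namespace Osculating

open MvPolynomial
open scoped LinearAlgebra.Projectivization

variable {K : Type*} [Field K]

/-! ### Derivatives, apolarity and inverse systems -/

/-- The iterated operator `D₀ ^ a₀ ∘ D₁ ^ a₁ ∘ ⋯` attached to a multi-index `a`.  With `D` the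
partial derivatives this is the mixed partial derivative of multi-order `a`. -/
def iterDeriv {M : Type*} [AddCommGroup M] [Module K M] {m : ℕ}
    (D : Fin m → Module.End K M) (a : Fin m →₀ ℕ) : Module.End K M :=
  (List.ofFn fun i => D i ^ a i).prod

/-- The polynomial `α` acting on polynomials as a differential operator: the variable `X i` of `α`
acts as `∂ / ∂ x i`. -/
def apolarAction {m : ℕ} (α : MvPolynomial (Fin m) K) :
    Module.End K (MvPolynomial (Fin m) K) :=
  ∑ a ∈ α.support, α.coeff a •
    iterDeriv (fun i => (pderiv i : Derivation K _ _).toLinearMap) a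

/-- Macaulay's inverse system of `I`: all `f` with `α(f) = 0` for every `α ∈ I`. -/
def inverseSystem {m : ℕ} (I : Ideal (MvPolynomial (Fin m) K)) :
    Submodule K (MvPolynomial (Fin m) K) :=
  ⨅ α ∈ I, LinearMap.ker (apolarAction α)

/-- The degree `k` piece of the inverse system of `I`. -/
def inverseSystemDeg {m : ℕ} (I : Ideal (MvPolynomial (Fin m) K)) (k : ℕ) :
    Submodule K (MvPolynomial (Fin m) K) :=
  inverseSystem I ⊓ homogeneousSubmodule (Fin m) K k

/-! ### Graded quotient algebras and multiplication maps -/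

/-- The degree `k` piece `A_k` of `A = K[x] / I`. -/
def gradedPiece {m : ℕ} (I : Ideal (MvPolynomial (Fin m) K)) (k : ℕ) :
    Submodule K (MvPolynomial (Fin m) K ⧸ I) :=
  (homogeneousSubmodule (Fin m) K k).map (Ideal.Quotient.mkₐ K I).toLinearMap

theorem mk_mem_gradedPiece {m : ℕ} (I : Ideal (MvPolynomial (Fin m) K)) {k : ℕ}
    {f : MvPolynomial (Fin m) K} (hf : f.IsHomogeneous k) :
    Ideal.Quotient.mk I f ∈ gradedPiece I k :=
  ⟨f, hf, rfl⟩

theorem mul_mem_gradedPiece {m : ℕ} (I : Ideal (MvPolynomial (Fin m) K))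
    {L : MvPolynomial (Fin m) K} {i j k : ℕ} (hL : L.IsHomogeneous j) (h : i + j = k) :
    ∀ x ∈ gradedPiece I i,
      LinearMap.mulLeft K (Ideal.Quotient.mk I L) x ∈ gradedPiece I k := by
  rintro _ ⟨f, hf, rfl⟩
  have hf' : f.IsHomogeneous i := hf
  subst h
  exact ⟨L * f, by simpa [add_comm] using hL.mul hf', by simp⟩

/-- The multiplication map `×L : A_i → A_{i+j}` by a form `L` of degree `j`. -/
def mulMap {m : ℕ} (I : Ideal (MvPolynomial (Fin m) K))
    {L : MvPolynomial (Fin m) K} {i j k : ℕ} (hL : L.IsHomogeneous j) (h : i + j = k) :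
    gradedPiece I i →ₗ[K] gradedPiece I k :=
  (LinearMap.mulLeft K (Ideal.Quotient.mk I L)).restrict (mul_mem_gradedPiece I hL h)

/-- The linear form `x₀ + ⋯ + x_{m-1}`. -/
def sumForm (K : Type*) [Field K] (m : ℕ) : MvPolynomial (Fin m) K := ∑ i, X i

theorem sumForm_isHomogeneous (K : Type*) [Field K] (m : ℕ) :
    (sumForm K m).IsHomogeneous 1 :=
  IsHomogeneous.sum _ _ _ fun i _ => isHomogeneous_X K i

/-- The ideal `(x₀^d, …, x_n^d) + x₀^{d-1} (x₀, …, x_n)` of `K[x₀, …, x_n]`. -/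
def togliattiIdeal (K : Type*) [Field K] (n d : ℕ) : Ideal (MvPolynomial (Fin (n + 1)) K) :=
  Ideal.span (Set.range fun i => X i ^ d) ⊔
    Ideal.span {X 0 ^ (d - 1)} * Ideal.span (Set.range fun i => X i)

/-! ### Zariski topology of projective space -/

section Projective

variable {ι : Type*}

/-- The form `G` vanishes at the point `x` of projective space (only used for homogeneous `G`, so
the choice of the representative is irrelevant). -/
def VanishesAt (G : MvPolynomial ι K) (x : ℙ K (ι → K)) : Prop := eval x.rep G = 0

/-- Zariski closed subsets of projective space. -/
def IsZariskiClosed (Z : Set (ℙ K (ι → K))) : Prop :=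
  ∃ S : Set (MvPolynomial ι K), (∀ G ∈ S, ∃ k, G.IsHomogeneous k) ∧
    Z = {x | ∀ G ∈ S, VanishesAt G x}

/-- The Zariski closure of a subset of projective space. -/
def zariskiClosure (T : Set (ℙ K (ι → K))) : Set (ℙ K (ι → K)) :=
  ⋂₀ {Z | IsZariskiClosed Z ∧ T ⊆ Z}

/-- The homogeneous polynomials that vanish on the set `T`. -/
def vanishingForms (T : Set (ℙ K (ι → K))) : Set (MvPolynomial ι K) :=
  {G | (∃ k, G.IsHomogeneous k) ∧ ∀ x ∈ T, VanishesAt G x}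

/-- The image of the rational map `P ↦ (F_j(P))_j`, which is defined at those `P` at which some
`F_j` does not vanish. -/
def rationalImage {m : ℕ} (F : ι → MvPolynomial (Fin m) K) : Set (ℙ K (ι → K)) :=
  {y | ∃ (P : Fin m → K) (h : (fun j => eval P (F j)) ≠ 0),
    y = Projectivization.mk K (fun j => eval P (F j)) h}

/-- The closure of the image of the rational map given by the forms `F_j`. -/
def imageVariety {m : ℕ} (F : ι → MvPolynomial (Fin m) K) : Set (ℙ K (ι → K)) :=
  zariskiClosure (rationalImage F)

variable [Fintype ι]

/-- The vector space over the embedded (projective) Zariski tangent space of `T` at the point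
represented by `v`: the vectors killed by the differentials at `v` of all forms vanishing on `T`.
It contains `v`, and its dimension is one more than that of the Zariski tangent space. -/
def tangentCone (T : Set (ℙ K (ι → K))) (v : ι → K) : Submodule K (ι → K) :=
  ⨅ G ∈ vanishingForms T,
    LinearMap.ker (∑ i, eval v (pderiv i G) • (LinearMap.proj i : (ι → K) →ₗ[K] K))

/-! ### Local parametrizations, osculating spaces, Laplace equations -/

/-- The span of the values at `0` of all partial derivatives of order `≤ s` (order `0` included) of
the tuple of power series `φ`.  This is the vector space over the `s`-th osculating space at
`φ(0)` of the variety parametrized by `φ`. -/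
def jetSpan {m : ℕ} (φ : ι → MvPowerSeries (Fin m) K) (s : ℕ) : Submodule K (ι → K) :=
  Submodule.span K {w | ∃ a : Fin m →₀ ℕ, a.degree ≤ s ∧
    w = fun j => MvPowerSeries.constantCoeff
      (iterDeriv (fun i => (MvPowerSeries.pderiv K i).toLinearMap) a (φ j))}

/-- `φ` is a formal local parametrization, by `m` parameters, of `T` at the smooth point `x`, in
homogeneous coordinates: `φ(0)` represents `x`, all equations of `T` hold identically on `φ`, and
the `m + 1` vectors `φ(0), ∂₁φ(0), …, ∂ₘφ(0)` are a basis of the (vector space over the) Zariski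
tangent space of `T` at `x`.  Equivalently, `φ` induces an isomorphism of the completed local ring
of `T` at `x` with `K⟦t₁, …, tₘ⟧`; such a `φ` exists if and only if `x` is a smooth point of `T`
at which `T` has dimension `m`. -/
structure IsLocalParametrization {m : ℕ} (T : Set (ℙ K (ι → K))) (x : ℙ K (ι → K))
    (φ : ι → MvPowerSeries (Fin m) K) : Prop where
  base_mem : x ∈ T
  base : ∃ h : (fun j => MvPowerSeries.constantCoeff (φ j)) ≠ 0,
    Projectivization.mk K (fun j => MvPowerSeries.constantCoeff (φ j)) h = x
  equations : ∀ G ∈ vanishingForms T, aeval φ G = 0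
  tangent : jetSpan φ 1 = tangentCone T (fun j => MvPowerSeries.constantCoeff (φ j))
  finrank_tangent : Module.finrank K (jetSpan φ 1) = m + 1

/-- The projective dimension of the `s`-th osculating space given by the parametrization `φ`. -/
def osculatingDim {m : ℕ} (φ : ι → MvPowerSeries (Fin m) K) (s : ℕ) : ℤ :=
  (Module.finrank K (jetSpan φ s) : ℤ) - 1

/-- The `n`-dimensional projective variety `T` satisfies (exactly) `δ` Laplace equations of order
`s`: the points of a dense Zariski open subset of `T` are smooth points at which `T` has dimension
`n`, and the `s`-th osculating space there has dimension `binom(n+s, s) - 1 - δ`. -/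
def SatisfiesLaplaceEquations (T : Set (ℙ K (ι → K))) (n s δ : ℕ) : Prop :=
  T.Nonempty ∧ ∃ Z : Set (ℙ K (ι → K)), IsZariskiClosed Z ∧ T ⊆ zariskiClosure (T \ Z) ∧
    ∀ x ∈ T \ Z,
      (∃ φ : ι → MvPowerSeries (Fin n) K, IsLocalParametrization T x φ) ∧
      ∀ φ : ι → MvPowerSeries (Fin n) K, IsLocalParametrization T x φ →
        osculatingDim φ s = ((n + s).choose s : ℤ) - 1 - δ

end Projective

end Osculating

end

noncomputable section

namespace Osculating

open MvPolynomial
open scoped LinearAlgebra.Projectivization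

variable {K : Type*} [Field K]

/-! ### Iterated derivatives -/

section IterDeriv

variable {M : Type*} [AddCommGroup M] [Module K M] {m : ℕ} (D : Fin m → Module.End K M)

/-! Write `L_P = ∑ P_i x_i`. The Laplace equation and the kernel of the multiplication map are the
same phenomenon, by apolarity.

Algebra. If `L_P D` lies in `I` with `deg D = d - 1` and all `P_i ≠ 0`, then `L_P D = x_0^(d-1) Q +
∑ c_i x_i^d` with `i ≥ 1` in the sum. On the subspace `x_0 = L_P = 0` this leaves a relation between
`d`-th powers, which forces every `c_i = 0`. Hence `x_0^(d-1)` divides `D`, so `D` is a multiple of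
it (`eq_C_mul_X_pow_of_linearForm_mul`). The case `P = (1, …, 1)` is the statement about the kernel.

Duality. For `|b| = d - 1` the derivative `∂^b F_j` is a linear form with value `(L_P x^b)(F_j)` at
`P`. Linear relations between the vectors `(∂^b F_j(P))_j` are therefore forms `D` with `L_P D` in
`I`; they form a line, and the vectors span a space of dimension `binom(n+d-1, d-1) - 1`
(`finrank_span_derivVector`).

Geometry. This span lies over the osculating space. With `c = x_1^(d-2) x_2`, every `c x_i` lies in
the inverse system, so the rational map has an inverse given by linear forms
(`exists_hasLinearInverse`). Any local parametrization then lifts to `φ_j = g F_j(p)` with `g` a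
unit. By Euler's formula and the chain rule, a form `G` of degree `d` vanishes to order `d` along
`p` iff its derivatives of order `d - 1` vanish at `p(0)` (`vanishesToOrder_aeval_iff`). The linear
inverse also shows that `X_d` is smooth of dimension `n` at its points where no inverse form
vanishes. -/

theorem iterDeriv_zero : iterDeriv D 0 = 1 := by
  simp [iterDeriv, List.ofFn_const]

variable {D} in
theorem iterDeriv_add_single (hD : ∀ i j, Commute (D i) (D j)) (a : Fin m →₀ ℕ) (j : Fin m) :
    iterDeriv D (a + Finsupp.single j 1) = iterDeriv D a * D j := by
  -- Arbitrary lists allow induction: each occurrence of `j` contributes one extra factor `D j`, and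
  -- `List.finRange m` contains `j` exactly once.
  have key : ∀ l : List (Fin m),
      (l.map fun i => D i ^ (a + Finsupp.single j 1 : Fin m →₀ ℕ) i).prod =
        (l.map fun i => D i ^ a i).prod * D j ^ l.count j := by
    intro l
    induction l with
    | nil => simp
    | cons i l ih =>
      rw [List.map_cons, List.prod_cons, ih, List.map_cons, List.prod_cons, List.count_cons]
      by_cases h : i = j
      · subst h
        have hc : Commute (D i) (l.map fun i => D i ^ a i).prod :=
          Commute.list_prod_right _ _ fun x hx => by
            obtain ⟨y, -, rfl⟩ := List.mem_map.1 hx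
            exact (hD i y).pow_right _
        simp only [Finsupp.add_apply, Finsupp.single_eq_same, beq_self_eq_true, if_true]
        rw [pow_succ, pow_succ', mul_assoc, mul_assoc, ← mul_assoc (D i), hc.eq, mul_assoc]
      · simp [h, mul_assoc]
  have := key (List.finRange m)
  rw [List.count_eq_one_of_mem (List.nodup_finRange m) (List.mem_finRange j), pow_one] at this
  simpa [iterDeriv, List.ofFn_eq_map] using this

theorem exists_eq_add_single {a : Fin m →₀ ℕ} {k : ℕ} (h : a.degree = k + 1) :
    ∃ (b : Fin m →₀ ℕ) (j : Fin m), b.degree = k ∧ a = b + Finsupp.single j 1 := by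
  obtain ⟨j, hj⟩ : ∃ j, a j ≠ 0 := by
    by_contra! h0
    have : a = 0 := Finsupp.ext h0
    simp [this] at h
  have hle : Finsupp.single j 1 ≤ a := by
    rw [Finsupp.single_le_iff]; omega
  have e : a - Finsupp.single j 1 + Finsupp.single j 1 = a := tsub_add_cancel_of_le hle
  refine ⟨a - Finsupp.single j 1, j, ?_, e.symm⟩
  have := congrArg Finsupp.degree e
  rw [map_add, Finsupp.degree_single] at this
  omega

end IterDeriv

/-! ### Mixed partial derivatives of polynomials and power series -/

theorem commute_pderiv {m : ℕ} (i j : Fin m) :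
    Commute ((pderiv i : Derivation K _ _).toLinearMap : Module.End K (MvPolynomial (Fin m) K))
      (pderiv j : Derivation K _ _).toLinearMap := by
  refine LinearMap.ext fun f => ?_
  ext a
  simp only [Module.End.mul_apply, Derivation.coeFn_coe, coeff_pderiv]
  rw [add_right_comm]
  by_cases h : i = j
  · subst h; ring
  · simp [h, Ne.symm h]; ring

theorem commute_powerSeries_pderiv {m : ℕ} (i j : Fin m) :
    Commute ((MvPowerSeries.pderiv K i).toLinearMap : Module.End K (MvPowerSeries (Fin m) K))
      (MvPowerSeries.pderiv K j).toLinearMap := by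
  refine LinearMap.ext fun f => ?_
  ext a
  simp only [Module.End.mul_apply, Derivation.coeFn_coe,
    MvPowerSeries.coeff_pderiv]
  rw [add_right_comm]
  by_cases h : i = j
  · subst h; ring
  · simp [h, Ne.symm h]; ring

/-- The mixed partial derivative of multi-order `a` of a polynomial. -/
abbrev polyDeriv {m : ℕ} (a : Fin m →₀ ℕ) : Module.End K (MvPolynomial (Fin m) K) :=
  iterDeriv (fun i => (pderiv i : Derivation K _ _).toLinearMap) a

/-- The mixed partial derivative of multi-order `a` of a power series. -/
abbrev seriesDeriv {m : ℕ} (a : Fin m →₀ ℕ) : Module.End K (MvPowerSeries (Fin m) K) :=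
  iterDeriv (fun i => (MvPowerSeries.pderiv K i).toLinearMap) a

theorem polyDeriv_add_single {m : ℕ} (a : Fin m →₀ ℕ) (j : Fin m) (f : MvPolynomial (Fin m) K) :
    polyDeriv (a + Finsupp.single j 1) f = polyDeriv a (pderiv j f) := by
  rw [polyDeriv, iterDeriv_add_single commute_pderiv]; rfl

theorem seriesDeriv_add_single {m : ℕ} (a : Fin m →₀ ℕ) (j : Fin m)
    (f : MvPowerSeries (Fin m) K) :
    seriesDeriv (a + Finsupp.single j 1) f = seriesDeriv a (MvPowerSeries.pderiv K j f) := by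
  rw [seriesDeriv, iterDeriv_add_single commute_powerSeries_pderiv]; rfl

theorem polyDeriv_zero {m : ℕ} (f : MvPolynomial (Fin m) K) : polyDeriv 0 f = f := by
  rw [polyDeriv, iterDeriv_zero]; rfl

theorem seriesDeriv_zero {m : ℕ} (f : MvPowerSeries (Fin m) K) : seriesDeriv 0 f = f := by
  rw [seriesDeriv, iterDeriv_zero]; rfl

/-- The factorial of a multi-index. -/
def multiFactorial {m : ℕ} (a : Fin m →₀ ℕ) : ℕ := ∏ i, (a i).factorial

theorem multiFactorial_ne_zero {m : ℕ} (a : Fin m →₀ ℕ) : multiFactorial a ≠ 0 :=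
  Finset.prod_ne_zero_iff.2 fun _ _ => Nat.factorial_ne_zero _

theorem multiFactorial_zero {m : ℕ} : multiFactorial (0 : Fin m →₀ ℕ) = 1 := by
  simp [multiFactorial]

theorem multiFactorial_add_single {m : ℕ} (a : Fin m →₀ ℕ) (j : Fin m) :
    multiFactorial (a + Finsupp.single j 1) = multiFactorial a * (a j + 1) := by
  unfold multiFactorial
  rw [← Finset.mul_prod_erase _ _ (Finset.mem_univ j),
    ← Finset.mul_prod_erase _ _ (Finset.mem_univ j)]
  have : ∏ i ∈ Finset.univ.erase j, ((a + Finsupp.single j 1 : Fin m →₀ ℕ) i).factorial =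
      ∏ i ∈ Finset.univ.erase j, (a i).factorial := by
    refine Finset.prod_congr rfl fun i hi => ?_
    rw [Finset.mem_erase] at hi
    simp [Ne.symm hi.1]
  rw [this]
  simp [Nat.factorial_succ]
  ring

/-- The factor `c!` on the left avoids the quotient `(a + c)! / c!` by which differentiation scales
coefficients. -/
theorem multiFactorial_mul_coeff_polyDeriv {m : ℕ} (a c : Fin m →₀ ℕ)
    (f : MvPolynomial (Fin m) K) :
    (multiFactorial c : K) * coeff c (polyDeriv a f) =
      multiFactorial (a + c) * coeff (a + c) f := by
  obtain ⟨k, hk⟩ : ∃ k, a.degree = k := ⟨_, rfl⟩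
  induction k generalizing a f with
  | zero =>
    rw [(Finsupp.degree_eq_zero_iff a).1 hk, polyDeriv_zero, zero_add]
  | succ k ih =>
    obtain ⟨b, j, hb, rfl⟩ := exists_eq_add_single hk
    rw [polyDeriv_add_single, ih b _ hb, coeff_pderiv, add_right_comm b _ c,
      multiFactorial_add_single]
    push_cast
    ring

theorem isHomogeneous_polyDeriv {m : ℕ} {a : Fin m →₀ ℕ} {f : MvPolynomial (Fin m) K} {k : ℕ}
    (hf : f.IsHomogeneous k) : (polyDeriv a f).IsHomogeneous (k - a.degree) := by
  obtain ⟨e, he⟩ : ∃ k, a.degree = k := ⟨_, rfl⟩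
  induction e generalizing a f k with
  | zero => rw [(Finsupp.degree_eq_zero_iff a).1 he, polyDeriv_zero]; simpa using hf
  | succ e ih =>
    obtain ⟨b, j, hb, rfl⟩ := exists_eq_add_single he
    rw [polyDeriv_add_single]
    have := ih (hf.pderiv (i := j)) hb
    rw [map_add, Finsupp.degree_single, hb]
    rw [hb] at this
    rwa [Nat.sub_sub, add_comm 1 e] at this

/-! ### Order of vanishing of power series -/

/-- All derivatives of order `< k` of the power series `f` vanish at `0`. -/
def VanishesToOrder {m : ℕ} (k : ℕ) (f : MvPowerSeries (Fin m) K) : Prop :=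
  ∀ a : Fin m →₀ ℕ, a.degree < k → MvPowerSeries.constantCoeff (seriesDeriv a f) = 0

namespace VanishesToOrder

variable {m k : ℕ} {f g : MvPowerSeries (Fin m) K}

theorem mono {l : ℕ} (h : VanishesToOrder k f) (hl : l ≤ k) : VanishesToOrder l f :=
  fun a ha => h a (ha.trans_le hl)

theorem add (hf : VanishesToOrder k f) (hg : VanishesToOrder k g) : VanishesToOrder k (f + g) :=
  fun a ha => by rw [map_add, map_add, hf a ha, hg a ha, add_zero]

theorem zero : VanishesToOrder k (0 : MvPowerSeries (Fin m) K) :=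
  fun a _ => by rw [map_zero, map_zero]

theorem sum {ι : Type*} {s : Finset ι} {f : ι → MvPowerSeries (Fin m) K}
    (h : ∀ i ∈ s, VanishesToOrder k (f i)) : VanishesToOrder k (∑ i ∈ s, f i) :=
  Finset.sum_induction _ _ (fun _ _ => add) zero h

theorem succ_iff : VanishesToOrder (k + 1) f ↔
    MvPowerSeries.constantCoeff f = 0 ∧ ∀ i, VanishesToOrder k (MvPowerSeries.pderiv K i f) := by
  constructor
  · refine fun h => ⟨?_, fun i a ha => ?_⟩
    · simpa [seriesDeriv_zero] using h 0 (by simp)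
    · rw [← seriesDeriv_add_single]
      exact h _ (by rw [map_add, Finsupp.degree_single]; omega)
  · rintro ⟨h0, h⟩ a ha
    rcases Nat.eq_zero_or_pos a.degree with h' | h'
    · rw [(Finsupp.degree_eq_zero_iff a).1 h', seriesDeriv_zero, h0]
    · obtain ⟨b, j, hb, rfl⟩ := exists_eq_add_single (Nat.sub_add_cancel h').symm
      rw [seriesDeriv_add_single]
      exact h j b (by omega)

theorem mul_left (hf : VanishesToOrder k f) (g : MvPowerSeries (Fin m) K) :
    VanishesToOrder k (g * f) := by
  induction k generalizing f g with
  | zero => exact fun a ha => absurd ha (Nat.not_lt_zero _)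
  | succ k ih =>
    have hf' := succ_iff.1 hf
    refine succ_iff.2 ⟨by rw [map_mul, hf'.1, mul_zero], fun i => ?_⟩
    rw [Derivation.leibniz, smul_eq_mul, smul_eq_mul, mul_comm f]
    exact (ih (hf'.2 i) g).add (ih (hf.mono k.le_succ) _)

theorem mul_left_iff {u : MvPowerSeries (Fin m) K} (hu : IsUnit u) :
    VanishesToOrder k (u * f) ↔ VanishesToOrder k f := by
  refine ⟨fun h => ?_, fun h => h.mul_left u⟩
  obtain ⟨v, hv⟩ := hu.exists_left_inv
  have := h.mul_left v
  rwa [← mul_assoc, hv, one_mul] at this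

end VanishesToOrder

/-! ### The chain rule along a tuple of power series -/

theorem constantCoeff_aeval {ι : Type*} {m : ℕ} (p : ι → MvPowerSeries (Fin m) K)
    (G : MvPolynomial ι K) :
    MvPowerSeries.constantCoeff (aeval p G) =
      eval (fun j => MvPowerSeries.constantCoeff (p j)) G := by
  induction G using MvPolynomial.induction_on with
  | C a => simp [MvPowerSeries.algebraMap_apply]
  | add f g hf hg => simp [hf, hg]
  | mul_X f i hf => simp [hf]

theorem derivation_aeval {ι A : Type*} [Fintype ι] [CommRing A] [Algebra K A]
    (δ : Derivation K A A) (p : ι → A) (G : MvPolynomial ι K) :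
    δ (aeval p G) = ∑ j, aeval p (pderiv j G) * δ (p j) := by
  classical
  induction G using MvPolynomial.induction_on with
  | C a => simp
  | add f g hf hg => simp [hf, hg, add_mul, Finset.sum_add_distrib]
  | mul_X f i hf =>
    simp only [map_mul, aeval_X, Derivation.leibniz, hf, smul_eq_mul, map_add, pderiv_X, add_mul,
      Finset.sum_add_distrib, Finset.mul_sum]
    congr 1
    · rw [Finset.sum_eq_single i (fun j _ hj => by simp [hj.symm]) (by simp)]
      simp
    · exact Finset.sum_congr rfl fun j _ => by ring

theorem euler_aeval {ι A : Type*} [Fintype ι] [CommRing A] [Algebra K A] {k : ℕ}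
    {G : MvPolynomial ι K} (hG : G.IsHomogeneous k) (p : ι → A) :
    ∑ j, aeval p (pderiv j G) * p j = k • aeval p G := by
  have := congrArg (aeval p) hG.sum_X_mul_pderiv
  rw [map_sum, map_nsmul] at this
  rw [← this]
  exact Finset.sum_congr rfl fun j _ => by rw [map_mul, aeval_X, mul_comm]

/-- The constant terms of a tuple of power series and of its first derivatives. -/
def frame {ι : Type*} {m : ℕ} (p : ι → MvPowerSeries (Fin m) K) : Fin (m + 1) → ι → K :=
  Fin.cons (fun j => MvPowerSeries.constantCoeff (p j))
    fun i j => MvPowerSeries.constantCoeff (MvPowerSeries.pderiv K i (p j))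

/-- The square matrix with rows `p, ∂_1 p, …, ∂_n p` is invertible over the power series ring, since
its constant term is. By Euler's formula and the chain rule it maps the tuple `(∂_j G)(p)` to `e
G(p), ∂_1(G(p)), …, ∂_n(G(p))`, so the two tuples vanish to the same order. -/
theorem vanishesToOrder_pderiv {n e k : ℕ} [CharZero K] {p : Fin (n + 1) → MvPowerSeries (Fin n) K}
    (hp : LinearIndependent K (frame p)) {G : MvPolynomial (Fin (n + 1)) K}
    (hG : G.IsHomogeneous e) (he : e ≠ 0) :
    VanishesToOrder (k + 2) (aeval p G) ↔ ∀ j, VanishesToOrder (k + 1) (aeval p (pderiv j G)) := by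
  let A : Matrix (Fin (n + 1)) (Fin (n + 1)) (MvPowerSeries (Fin n) K) :=
    Matrix.of (Fin.cons p fun i j => MvPowerSeries.pderiv K i (p j))
  have hmap : MvPowerSeries.constantCoeff.mapMatrix A = Matrix.of (frame p) := by
    ext i j
    refine Fin.cases ?_ (fun i => ?_) i <;> simp [A, frame]
  have hA : IsUnit A.det := by
    rw [MvPowerSeries.isUnit_iff_constantCoeff, RingHom.map_det, hmap]
    exact (Matrix.isUnit_iff_isUnit_det _).1 (Matrix.linearIndependent_rows_iff_isUnit.1 hp)
  have h0 : A.mulVec (fun j => aeval p (pderiv j G)) 0 = e • aeval p G := by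
    rw [← euler_aeval hG p]
    simp [A, Matrix.mulVec, dotProduct, mul_comm]
  have hs (i : Fin n) : A.mulVec (fun j => aeval p (pderiv j G)) i.succ =
      MvPowerSeries.pderiv K i (aeval p G) := by
    rw [derivation_aeval]
    simp [A, Matrix.mulVec, dotProduct, mul_comm]
  constructor
  · intro h j
    have h1 : (fun j => aeval p (pderiv j G)) =
        A⁻¹.mulVec (A.mulVec fun j => aeval p (pderiv j G)) := by
      rw [Matrix.mulVec_mulVec, Matrix.nonsing_inv_mul _ hA, Matrix.one_mulVec]
    rw [show aeval p (pderiv j G) = A⁻¹.mulVec (A.mulVec fun j => aeval p (pderiv j G)) j from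
      congrFun h1 j]
    change VanishesToOrder (k + 1)
      (∑ i, A⁻¹ j i * A.mulVec (fun j => aeval p (pderiv j G)) i)
    refine VanishesToOrder.sum fun i _ => VanishesToOrder.mul_left ?_ _
    refine Fin.cases ?_ (fun i => ?_) i
    · rw [h0, nsmul_eq_mul]
      exact (h.mono (Nat.le_succ _)).mul_left _
    · rw [hs]
      exact (VanishesToOrder.succ_iff.1 h).2 i
  · intro h
    have hsum (q : Fin (n + 1) → MvPowerSeries (Fin n) K) :
        VanishesToOrder (k + 1) (∑ j, aeval p (pderiv j G) * q j) :=
      VanishesToOrder.sum fun j _ => by rw [mul_comm]; exact (h j).mul_left _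
    refine VanishesToOrder.succ_iff.2 ⟨?_, fun i => ?_⟩
    -- Euler's formula gives the constant term of `e G(p)`; characteristic zero and `e ≠ 0` allow
    -- division by `e`.
    · have := hsum p
      rw [euler_aeval hG p] at this
      have := (VanishesToOrder.succ_iff.1 this).1
      rw [nsmul_eq_mul, map_mul, map_natCast] at this
      exact (mul_eq_zero.1 this).resolve_left (Nat.cast_ne_zero.2 he)
    · rw [derivation_aeval]
      exact hsum _

/-- Iterates `vanishesToOrder_pderiv`; the bound `k < e` keeps the degree positive at each
differentiation. -/
theorem vanishesToOrder_aeval_iff {n e k : ℕ} [CharZero K]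
    {p : Fin (n + 1) → MvPowerSeries (Fin n) K}
    (hp : LinearIndependent K (frame p)) {G : MvPolynomial (Fin (n + 1)) K}
    (hG : G.IsHomogeneous e) (he : k < e) :
    VanishesToOrder (k + 1) (aeval p G) ↔ ∀ b : Fin (n + 1) →₀ ℕ, b.degree = k →
      eval (fun j => MvPowerSeries.constantCoeff (p j)) (polyDeriv b G) = 0 := by
  induction k generalizing G e with
  | zero =>
    rw [VanishesToOrder.succ_iff, constantCoeff_aeval]
    constructor
    · intro h b hb
      rw [(Finsupp.degree_eq_zero_iff b).1 hb, polyDeriv_zero]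
      exact h.1
    · intro h
      refine ⟨?_, fun i a ha => absurd ha (Nat.not_lt_zero _)⟩
      simpa [polyDeriv_zero] using h 0 (by simp)
  | succ k ih =>
    rw [vanishesToOrder_pderiv hp hG (by omega)]
    constructor
    · intro h b hb
      obtain ⟨c, j, hc, rfl⟩ := exists_eq_add_single hb
      rw [polyDeriv_add_single]
      exact (ih hG.pderiv (by omega)).1 (h j) c hc
    · intro h j
      refine (ih hG.pderiv (by omega)).2 fun b hb => ?_
      rw [← polyDeriv_add_single]
      exact h _ (by rw [map_add, Finsupp.degree_single, hb])

/-! ### The monomials of degree `d` in the ideal -/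

/-- The exponents `d e_i` and `(d - 1) e_0 + e_i` of the generators of `togliattiIdeal`. -/
def generatorExponents (n d : ℕ) : Set (Fin (n + 1) →₀ ℕ) :=
  Set.range (fun i => Finsupp.single i d) ∪
    Set.range (fun i => Finsupp.single 0 (d - 1) + Finsupp.single i 1)

theorem degree_of_mem_generatorExponents {n d : ℕ} (hd : 1 ≤ d) {s : Fin (n + 1) →₀ ℕ}
    (hs : s ∈ generatorExponents n d) : s.degree = d := by
  rcases hs with ⟨i, rfl⟩ | ⟨i, rfl⟩
  · exact Finsupp.degree_single _ _
  · rw [map_add, Finsupp.degree_single, Finsupp.degree_single]; omega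

theorem monomial_mem_togliattiIdeal {n d : ℕ} {s : Fin (n + 1) →₀ ℕ}
    (hs : s ∈ generatorExponents n d) : monomial s (1 : K) ∈ togliattiIdeal K n d := by
  rcases hs with ⟨i, rfl⟩ | ⟨i, rfl⟩
  · refine Ideal.mem_sup_left (Ideal.subset_span ⟨i, ?_⟩)
    exact X_pow_eq_monomial
  · refine Ideal.mem_sup_right ?_
    rw [← one_mul (1 : K), ← monomial_mul, ← X_pow_eq_monomial]
    exact Ideal.mul_mem_mul (Ideal.subset_span rfl) (Ideal.subset_span ⟨i, rfl⟩)

/-- The generators are monomials, so membership in the ideal constrains each monomial of a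
polynomial separately. -/
theorem togliattiIdeal_le (n d : ℕ) : togliattiIdeal K n d ≤
    Ideal.span ((fun s => monomial s (1 : K)) '' generatorExponents n d) := by
  refine sup_le (Ideal.span_le.2 ?_) ?_
  · rintro _ ⟨i, rfl⟩
    exact Ideal.subset_span ⟨_, Or.inl ⟨i, rfl⟩, X_pow_eq_monomial.symm⟩
  · rw [Ideal.span_mul_span', Ideal.span_le]
    rintro _ ⟨_, rfl, _, ⟨i, rfl⟩, rfl⟩
    refine Ideal.subset_span ⟨_, Or.inr ⟨i, rfl⟩, ?_⟩
    change monomial (Finsupp.single 0 (d - 1) + Finsupp.single i 1) (1 : K) = X 0 ^ (d - 1) * X i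
    rw [X_pow_eq_monomial, X, monomial_mul, one_mul]

theorem exists_le_of_mem_togliattiIdeal {n d : ℕ} {α : MvPolynomial (Fin (n + 1)) K}
    (hα : α ∈ togliattiIdeal K n d) {a : Fin (n + 1) →₀ ℕ} (ha : coeff a α ≠ 0) :
    ∃ s ∈ generatorExponents n d, s ≤ a :=
  mem_ideal_span_monomial_image.1 (togliattiIdeal_le n d hα) a (mem_support_iff.2 ha)

theorem eq_of_le_of_degree_le {m : ℕ} {s a : Fin m →₀ ℕ} (h : s ≤ a) (hd : a.degree ≤ s.degree) :
    s = a := by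
  have h1 : s + (a - s) = a := add_tsub_cancel_of_le h
  have h2 := congrArg Finsupp.degree h1
  rw [map_add] at h2
  have h3 : a - s = 0 := (Finsupp.degree_eq_zero_iff _).1 (by omega)
  rw [h3, add_zero] at h1
  exact h1

/-- All generators have degree exactly `d`, so a monomial of degree at most `d` divisible by one of
them equals it. -/
theorem mem_generatorExponents_of_mem {n d : ℕ} (hd : 1 ≤ d) {α : MvPolynomial (Fin (n + 1)) K}
    (hα : α ∈ togliattiIdeal K n d) {a : Fin (n + 1) →₀ ℕ} (ha : coeff a α ≠ 0)
    (had : a.degree ≤ d) : a ∈ generatorExponents n d := by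
  obtain ⟨s, hs, hsa⟩ := exists_le_of_mem_togliattiIdeal hα ha
  rwa [← eq_of_le_of_degree_le hsa (by rwa [degree_of_mem_generatorExponents hd hs])]

theorem X_zero_pow_notMem_togliattiIdeal {n d : ℕ} (hd : 1 ≤ d) :
    (X 0 ^ (d - 1) : MvPolynomial (Fin (n + 1)) K) ∉ togliattiIdeal K n d := by
  intro h
  have hc : coeff (Finsupp.single 0 (d - 1)) (X 0 ^ (d - 1) : MvPolynomial (Fin (n + 1)) K) ≠ 0 := by
    rw [X_pow_eq_monomial, coeff_monomial]; simp
  have hs := mem_generatorExponents_of_mem hd h hc (by rw [Finsupp.degree_single]; omega)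
  have := degree_of_mem_generatorExponents hd hs
  rw [Finsupp.degree_single] at this
  omega

/-! ### The inverse system in degree `d` in terms of coefficients -/

theorem eq_C_of_isHomogeneous_zero {m : ℕ} {f : MvPolynomial (Fin m) K} (hf : f.IsHomogeneous 0) :
    f = C (coeff 0 f) :=
  totalDegree_eq_zero_iff_eq_C.1 ((totalDegree_zero_iff_isHomogeneous _).2 hf)

theorem apolarAction_apply {m : ℕ} (α f : MvPolynomial (Fin m) K) :
    apolarAction α f = ∑ a ∈ α.support, α.coeff a • polyDeriv a f := by
  simp [apolarAction, polyDeriv]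

theorem polyDeriv_eq_zero_of_lt {m d : ℕ} {f : MvPolynomial (Fin m) K} (hf : f.IsHomogeneous d)
    {a : Fin m →₀ ℕ} (ha : d < a.degree) : polyDeriv a f = 0 := by
  obtain ⟨k, hk⟩ : ∃ k, a.degree = k := ⟨_, rfl⟩
  induction k generalizing a f d with
  | zero => omega
  | succ k ih =>
    obtain ⟨b, j, hb, rfl⟩ := exists_eq_add_single hk
    rw [polyDeriv_add_single]
    rcases Nat.eq_zero_or_pos d with rfl | h
    · rw [eq_C_of_isHomogeneous_zero hf, pderiv_C, map_zero]
    · exact ih hf.pderiv (by omega) hb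

theorem polyDeriv_of_degree_eq {m d : ℕ} {f : MvPolynomial (Fin m) K} (hf : f.IsHomogeneous d)
    {a : Fin m →₀ ℕ} (ha : a.degree = d) :
    polyDeriv a f = C ((multiFactorial a : K) * coeff a f) := by
  have h := isHomogeneous_polyDeriv (a := a) hf
  rw [ha, Nat.sub_self] at h
  rw [eq_C_of_isHomogeneous_zero h]
  have := multiFactorial_mul_coeff_polyDeriv a 0 f
  rw [multiFactorial_zero, Nat.cast_one, one_mul, add_zero] at this
  rw [this]

/-- On forms of degree `d`, monomials of higher degree act as zero and a monomial `x^a` of degree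
`d` acts as `a!` times the coefficient at `a`. The only monomials of degree at most `d` occurring in
elements of the ideal are the generators. -/
theorem mem_inverseSystemDeg_iff [CharZero K] {n d : ℕ} (hd : 1 ≤ d)
    {f : MvPolynomial (Fin (n + 1)) K} :
    f ∈ inverseSystemDeg (togliattiIdeal K n d) d ↔
      f.IsHomogeneous d ∧ ∀ s ∈ generatorExponents n d, coeff s f = 0 := by
  rw [inverseSystemDeg, Submodule.mem_inf, mem_homogeneousSubmodule, and_comm]
  refine and_congr_right fun hf => ?_
  simp only [inverseSystem, Submodule.mem_iInf, LinearMap.mem_ker]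
  constructor
  · intro h s hs
    have := h _ (monomial_mem_togliattiIdeal hs)
    classical
    rw [apolarAction_apply, support_monomial, if_neg one_ne_zero, Finset.sum_singleton,
      coeff_monomial, if_pos rfl, one_smul,
      polyDeriv_of_degree_eq hf (degree_of_mem_generatorExponents hd hs), C_eq_zero] at this
    exact (mul_eq_zero.1 this).resolve_left (Nat.cast_ne_zero.2 (multiFactorial_ne_zero _))
  · intro h α hα
    rw [apolarAction_apply]
    refine Finset.sum_eq_zero fun a ha => ?_
    rcases lt_or_ge d a.degree with had | had
    · rw [polyDeriv_eq_zero_of_lt hf had, smul_zero]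
    · have hs := mem_generatorExponents_of_mem hd hα (mem_support_iff.1 ha) had
      rw [polyDeriv_of_degree_eq hf (degree_of_mem_generatorExponents hd hs), h a hs, mul_zero,
        map_zero, smul_zero]

theorem monomial_mem_inverseSystemDeg [CharZero K] {n d : ℕ} (hd : 1 ≤ d)
    {a : Fin (n + 1) →₀ ℕ} (ha : a.degree = d) (ha' : a ∉ generatorExponents n d) :
    monomial a (1 : K) ∈ inverseSystemDeg (togliattiIdeal K n d) d := by
  refine (mem_inverseSystemDeg_iff hd).2 ⟨isHomogeneous_monomial _ ha, fun s hs => ?_⟩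
  classical
  rw [coeff_monomial, if_neg]
  rintro rfl
  exact ha' hs

/-! ### Multiples of a linear form that lie in the ideal -/

/-- The test vectors `e_i - e_k`, `e_j - e_k` and `e_i + e_j - 2 e_k` give three equations;
eliminating `μ i` and `μ j` leaves `(-1)^d (2^d - 2) μ k = 0`. This is where three distinct indices
are needed. -/
theorem eq_zero_of_power_sums [CharZero K] {n d : ℕ} (hn : 3 ≤ n) (hd : 2 ≤ d) {μ : Fin n → K}
    (h : ∀ t : Fin n → K, ∑ i, t i = 0 → ∑ i, μ i * t i ^ d = 0) : μ = 0 := by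
  funext k
  obtain ⟨i, hi, j, hj, hij⟩ : ∃ i, i ≠ k ∧ ∃ j, j ≠ k ∧ i ≠ j := by
    have : 1 < (Finset.univ.erase k).card := by
      rw [Finset.card_erase_of_mem (Finset.mem_univ k), Finset.card_univ, Fintype.card_fin]
      omega
    obtain ⟨i, hi, j, hj, hij⟩ := Finset.one_lt_card.1 this
    exact ⟨i, (Finset.mem_erase.1 hi).1, j, (Finset.mem_erase.1 hj).1, hij⟩
  have hd0 : d ≠ 0 := by omega
  have two (i : Fin n) (hi : i ≠ k) : μ i + μ k * (-1) ^ d = 0 := by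
    have := h (Pi.single i 1 + Pi.single k (-1)) (by
      simp [Finset.sum_add_distrib])
    rw [← this, Finset.sum_eq_add i k hi]
    · simp [hi, hi.symm]
    · intro l _ hl
      simp [hl.1, hl.2, hd0]
    · simp
    · simp
  have three : μ i + (μ j + μ k * (-2) ^ d) = 0 := by
    have := h (Pi.single i 1 + Pi.single j 1 + Pi.single k (-2)) (by
      simp [Finset.sum_add_distrib]; norm_num)
    have hs : ∑ l, μ l * ((Pi.single i 1 + Pi.single j 1 + Pi.single k (-2) : Fin n → K) l) ^ d =
        ∑ l ∈ {i, j, k}, μ l * ((Pi.single i 1 + Pi.single j 1 + Pi.single k (-2) : Fin n → K) l) ^ d := by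
      symm
      refine Finset.sum_subset (Finset.subset_univ _) fun l _ hl => ?_
      simp only [Finset.mem_insert, Finset.mem_singleton, not_or] at hl
      simp [hl.1, hl.2.1, hl.2.2, hd0]
    rw [hs, Finset.sum_insert (by simp [hij, hi]), Finset.sum_insert (by simp [hj]),
      Finset.sum_singleton] at this
    simpa [hi, hj, hij, hi.symm, hj.symm, hij.symm] using this
  have h2 : (2 : K) ^ d - 2 ≠ 0 := by
    have : 2 ^ 2 ≤ 2 ^ d := Nat.pow_le_pow_right (by norm_num) hd
    rw [sub_ne_zero]
    have h' : (2 ^ d : ℕ) ≠ 2 := by omega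
    exact_mod_cast h'
  have h1 : (-1 : K) ^ d ≠ 0 := pow_ne_zero _ (by norm_num)
  have hk : μ k * ((-1) ^ d * (2 ^ d - 2)) = 0 := by
    have e : (-2 : K) ^ d = (-1) ^ d * 2 ^ d := by rw [← mul_pow]; norm_num
    rw [e] at three
    linear_combination three - two i hi - two j hj
  exact (mul_eq_zero.1 hk).resolve_right (mul_ne_zero h1 h2)

/-- The linear form with coefficients `P`. -/
def linearForm {m : ℕ} (P : Fin m → K) : MvPolynomial (Fin m) K := ∑ i, C (P i) * X i

theorem linearForm_isHomogeneous {m : ℕ} (P : Fin m → K) : (linearForm P).IsHomogeneous 1 :=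
  IsHomogeneous.sum _ _ _ fun _ _ => isHomogeneous_C_mul_X _ _

theorem eval_linearForm {m : ℕ} (P x : Fin m → K) : eval x (linearForm P) = ∑ i, P i * x i := by
  simp [linearForm]

/-- Apart from `x_1^d, …, x_n^d`, every generator is divisible by `x_0^(d-1)`, so the remainder
modulo this monomial involves only those powers. -/
theorem eq_X_pow_mul_add {n d : ℕ} (hd : 2 ≤ d) {E : MvPolynomial (Fin (n + 1)) K}
    (hE : ∀ a ∉ generatorExponents n d, coeff a E = 0) :
    ∃ (Q : MvPolynomial (Fin (n + 1)) K) (c : Fin n → K),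
      E = X 0 ^ (d - 1) * Q + ∑ i : Fin n, monomial (Finsupp.single i.succ d) (c i) := by
  classical
  refine ⟨divMonomial E (Finsupp.single 0 (d - 1)), fun i => coeff (Finsupp.single i.succ d) E, ?_⟩
  rw [X_pow_eq_monomial]
  nth_rw 1 [← divMonomial_add_modMonomial E (Finsupp.single 0 (d - 1))]
  congr 1
  ext a
  rw [coeff_sum]
  simp only [coeff_monomial]
  by_cases ha : Finsupp.single 0 (d - 1) ≤ a
  · rw [coeff_modMonomial_of_le _ ha, Finset.sum_eq_zero]
    intro i _
    rw [if_neg]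
    rintro rfl
    have := ha 0
    simp at this
    omega
  · rw [coeff_modMonomial_of_not_le _ ha]
    by_cases hai : ∃ i : Fin n, Finsupp.single i.succ d = a
    · obtain ⟨i, rfl⟩ := hai
      rw [Finset.sum_eq_single i, if_pos rfl]
      · intro j _ hj
        rw [if_neg]
        rw [Finsupp.single_eq_single_iff]
        simp [hj]
        omega
      · simp
    · push Not at hai
      rw [Finset.sum_eq_zero fun i _ => if_neg (hai i)]
      refine hE a fun h => ?_
      rcases h with ⟨i, rfl⟩ | ⟨i, rfl⟩
      · refine Fin.cases (fun hai ha => ?_) (fun i hai _ => hai i rfl) i hai ha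
        exact ha (Finsupp.single_mono (Nat.sub_le _ _))
      · exact ha le_self_add

theorem eq_C_mul_X_pow_of_linearForm_mul [CharZero K] {n d : ℕ} (hn : 3 ≤ n) (hd : 2 ≤ d)
    {P : Fin (n + 1) → K} (hP : ∀ i, P i ≠ 0) {D : MvPolynomial (Fin (n + 1)) K}
    (hD : D.IsHomogeneous (d - 1))
    (h : ∀ a ∉ generatorExponents n d, coeff a (linearForm P * D) = 0) :
    D = C (coeff (Finsupp.single 0 (d - 1)) D) * X 0 ^ (d - 1) := by
  obtain ⟨Q, c, hQ⟩ := eq_X_pow_mul_add hd h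
  have hc : (fun i => c i / P i.succ ^ d) = 0 := by
    refine eq_zero_of_power_sums hn hd fun t ht => ?_
    -- The point `x_0 = 0`, `x_i = t_i / P_i` lies on the hyperplane `L_P = 0` because the `t_i` sum
    -- to zero; the rescaling turns `c_i` into `c_i / P_i^d`.
    have := congrArg (eval (Fin.cons 0 fun i => t i / P i.succ : Fin (n + 1) → K)) hQ
    rw [map_mul, eval_linearForm, Fin.sum_univ_succ] at this
    have h0 : ∀ i, P i.succ * (t i / P i.succ) = t i := fun i => mul_div_cancel₀ _ (hP _)
    simp only [Fin.cons_zero, Fin.cons_succ, h0, ht, mul_zero, zero_add, zero_mul, map_add, map_mul,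
      map_pow, eval_X, map_sum, eval_monomial, zero_pow (show d - 1 ≠ 0 by omega),
      Finsupp.prod_single_index, pow_zero] at this
    rw [this]
    exact Finset.sum_congr rfl fun i _ => by rw [div_pow]; ring
  have hc' (i : Fin n) : c i = 0 := by
    have := congrFun hc i
    exact (div_eq_zero_iff.1 this).resolve_right (pow_ne_zero _ (hP _))
  simp only [hc', map_zero, Finset.sum_const_zero, add_zero] at hQ
  have hdvd : (X 0 : MvPolynomial (Fin (n + 1)) K) ^ (d - 1) ∣ D := by
    refine Prime.pow_dvd_of_dvd_mul_left X_prime _ ?_ ⟨Q, hQ⟩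
    rintro ⟨q, hq⟩
    -- At the basis vector `e_1` the variable `x_0` vanishes and the linear form has value `P_1 ≠
    -- 0`, so `x_0` does not divide it.
    let i : Fin n := ⟨0, by omega⟩
    have := congrArg (eval (Pi.single i.succ 1 : Fin (n + 1) → K)) hq
    rw [eval_linearForm, Fin.sum_univ_succ] at this
    simp [Pi.single_apply] at this
    exact hP _ this
  obtain ⟨q, hq⟩ := hdvd
  ext a
  rw [X_pow_eq_monomial, C_mul_monomial, mul_one]
  classical
  rw [coeff_monomial]
  split_ifs with ha
  · rw [ha]
  -- A monomial of `D` has degree `d - 1` and is divisible by `x_0^(d-1)`, hence equals it.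
  · by_contra h0
    have hdeg : a.degree = d - 1 := by
      by_contra h1
      exact h0 (hD.coeff_eq_zero h1)
    apply ha
    refine eq_of_le_of_degree_le ?_ (by rw [hdeg, Finsupp.degree_single])
    by_contra hle
    apply h0
    rw [hq, X_pow_eq_monomial, coeff_monomial_mul', if_neg hle]

/-! ### The kernel of the multiplication map -/

theorem sumForm_eq_linearForm (m : ℕ) : sumForm K m = linearForm 1 := by
  simp [sumForm, linearForm]

theorem ker_mulMap_togliattiIdeal [CharZero K] {n d : ℕ} (hn : 3 ≤ n) (hd : 2 ≤ d)
    (h : d - 1 + 1 = d) :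
    LinearMap.ker (mulMap (togliattiIdeal K n d) (sumForm_isHomogeneous K (n + 1)) h) =
      Submodule.span K {⟨Ideal.Quotient.mk (togliattiIdeal K n d) (X 0 ^ (d - 1)),
          mk_mem_gradedPiece _ (isHomogeneous_X_pow 0 (d - 1))⟩} := by
  apply le_antisymm
  · rintro ⟨_, D, hD, rfl⟩ hx
    have hx' : Ideal.Quotient.mk (togliattiIdeal K n d) (sumForm K (n + 1) * D) = 0 := by
      have := congrArg Subtype.val (LinearMap.mem_ker.1 hx)
      rw [map_mul]
      exact this
    rw [Ideal.Quotient.eq_zero_iff_mem, sumForm_eq_linearForm] at hx'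
    have hD' : D.IsHomogeneous (d - 1) := hD
    have hhom : (linearForm (1 : Fin (n + 1) → K) * D).IsHomogeneous d := by
      have := (linearForm_isHomogeneous (1 : Fin (n + 1) → K)).mul hD'
      rwa [add_comm 1, h] at this
    have hDC := eq_C_mul_X_pow_of_linearForm_mul hn hd (P := 1) (by simp) hD' fun a ha => by
      by_contra h0
      refine ha (mem_generatorExponents_of_mem (by omega) hx' h0 (le_of_eq ?_))
      by_contra h1
      exact h0 (hhom.coeff_eq_zero h1)
    refine Submodule.mem_span_singleton.2 ⟨coeff (Finsupp.single 0 (d - 1)) D, Subtype.ext ?_⟩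
    change _ • Ideal.Quotient.mkₐ K _ (X 0 ^ (d - 1)) = Ideal.Quotient.mkₐ K _ D
    rw [← map_smul, smul_eq_C_mul, ← hDC]
  · rw [Submodule.span_le, Set.singleton_subset_iff]
    refine LinearMap.mem_ker.2 (Subtype.ext ?_)
    change Ideal.Quotient.mk (togliattiIdeal K n d) (sumForm K (n + 1)) *
      Ideal.Quotient.mk (togliattiIdeal K n d) (X 0 ^ (d - 1)) = 0
    rw [← map_mul, Ideal.Quotient.eq_zero_iff_mem, sumForm, Finset.sum_mul]
    refine Ideal.sum_mem _ fun i _ => Ideal.mem_sup_right ?_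
    rw [mul_comm (X i)]
    exact Ideal.mul_mem_mul (Ideal.subset_span rfl) (Ideal.subset_span ⟨i, rfl⟩)

/-! ### The rank of the evaluated derivatives of order `d - 1` -/

theorem eval_of_isHomogeneous_one {m : ℕ} {f : MvPolynomial (Fin m) K} (hf : f.IsHomogeneous 1)
    (x : Fin m → K) : eval x f = ∑ i, x i * coeff (Finsupp.single i 1) f := by
  have h := congrArg (eval x) hf.sum_X_mul_pderiv
  rw [one_smul, map_sum] at h
  rw [← h]
  refine Finset.sum_congr rfl fun i _ => ?_
  have h0 : (pderiv i f).IsHomogeneous 0 := hf.pderiv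
  rw [map_mul, eval_X, eq_C_of_isHomogeneous_zero h0, eval_C, coeff_pderiv]
  simp

theorem eval_polyDeriv {m d : ℕ} {f : MvPolynomial (Fin m) K} (hf : f.IsHomogeneous d)
    {b : Fin m →₀ ℕ} (hb : b.degree + 1 = d) (x : Fin m → K) :
    eval x (polyDeriv b f) = ∑ i, x i * (multiFactorial (b + Finsupp.single i 1) *
      coeff (b + Finsupp.single i 1) f) := by
  have h := isHomogeneous_polyDeriv (a := b) hf
  rw [← hb, Nat.add_sub_cancel_left] at h
  rw [eval_of_isHomogeneous_one h]
  refine Finset.sum_congr rfl fun i _ => ?_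
  rw [← multiFactorial_mul_coeff_polyDeriv, ← zero_add (Finsupp.single i 1),
    multiFactorial_add_single, multiFactorial_zero]
  simp

/-- The multi-indices of degree `k` in `m` variables. -/
abbrev MultiIndex (m k : ℕ) : Type := {b : Fin m →₀ ℕ // b.degree = k}

/-- Multi-indices are multisets. -/
def multiIndexEquivSym (m k : ℕ) : MultiIndex m k ≃ Sym (Fin m) k :=
  (Sym.equivNatSum (Fin m) k).symm

instance (m k : ℕ) : Fintype (MultiIndex m k) := Fintype.ofEquiv _ (multiIndexEquivSym m k).symm

theorem card_multiIndex (m k : ℕ) : Fintype.card (MultiIndex m k) = (m + k - 1).choose k := by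
  rw [Fintype.card_congr (multiIndexEquivSym m k), Sym.card_sym_eq_choose, Fintype.card_fin]

/-- The values at `P` of the derivatives of multi-order `b` of the members of the family `F`. -/
def derivVector {ι : Type*} {m : ℕ} (F : ι → MvPolynomial (Fin m) K) (P : Fin m → K)
    (b : Fin m →₀ ℕ) : ι → K := fun j => eval P (polyDeriv b (F j))

/-- Rank-nullity for the family indexed by `b`: its relations are the coefficient tuples of forms
`D` with `L_P D` in the ideal, hence the multiples of `x_0^(d-1)`. -/
theorem finrank_span_derivVector [CharZero K] {n d : ℕ} (hn : 3 ≤ n) (hd : 2 ≤ d)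
    {ι : Type*} [Fintype ι]
    (F : Module.Basis ι K (inverseSystemDeg (togliattiIdeal K n d) d))
    {P : Fin (n + 1) → K} (hP : ∀ i, P i ≠ 0) :
    Module.finrank K (Submodule.span K (Set.range fun b : MultiIndex (n + 1) (d - 1) =>
      derivVector (fun j => (F j : MvPolynomial (Fin (n + 1)) K)) P b)) + 1 =
      (n + (d - 1)).choose (d - 1) := by
  classical
  set u := fun b : MultiIndex (n + 1) (d - 1) =>
      derivVector (fun j => (F j : MvPolynomial (Fin (n + 1)) K)) P b
  have hu (b j) : u b j = eval P (polyDeriv b (F j : MvPolynomial (Fin (n + 1)) K)) := rfl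
  have hF (j) := (mem_inverseSystemDeg_iff (by omega)).1 (F j).2
  have hdeg (b : MultiIndex (n + 1) (d - 1)) : b.1.degree + 1 = d := by rw [b.2]; omega
  let b₀ : MultiIndex (n + 1) (d - 1) := ⟨Finsupp.single 0 (d - 1), Finsupp.degree_single _ _⟩
  have hker : LinearMap.ker (Fintype.linearCombination K u) =
      Submodule.span K {Pi.single b₀ (1 : K)} := by
    apply le_antisymm
    · intro c hc
      rw [LinearMap.mem_ker, Fintype.linearCombination_apply] at hc
      -- On forms `G` of degree `d` this functional is the action of `L_P D`, where `D = ∑ c_b x^b`.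
      -- It kills the inverse system, and its value at `x^a` is `a!` times the coefficient of `L_P
      -- D` at `a`.
      let Λ : MvPolynomial (Fin (n + 1)) K →ₗ[K] K :=
        ∑ b : MultiIndex (n + 1) (d - 1), c b • ((aeval P).toLinearMap ∘ₗ polyDeriv b.1)
      have hΛ (G) : Λ G = ∑ b : MultiIndex (n + 1) (d - 1), c b * eval P (polyDeriv b.1 G) := by
        simp [Λ, aeval_eq_eval]
      have hΛ0 : Λ ∘ₗ (inverseSystemDeg (togliattiIdeal K n d) d).subtype = 0 := by
        refine F.ext fun j => ?_
        rw [LinearMap.comp_apply, Submodule.subtype_apply, hΛ, LinearMap.zero_apply]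
        have := congrFun hc j
        simpa [hu] using this
      let D : MvPolynomial (Fin (n + 1)) K :=
        ∑ b : MultiIndex (n + 1) (d - 1), monomial b.1 (c b)
      have hD : D.IsHomogeneous (d - 1) :=
        IsHomogeneous.sum _ _ _ fun b _ => isHomogeneous_monomial _ b.2
      have hLD : (linearForm P * D).IsHomogeneous d := by
        have := (linearForm_isHomogeneous P).mul hD
        rwa [show 1 + (d - 1) = d by omega] at this
      have hcoeff : ∀ a ∉ generatorExponents n d, coeff a (linearForm P * D) = 0 := by
        intro a ha
        by_cases had : a.degree = d
        · have h0 : Λ (monomial a 1) = 0 :=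
            LinearMap.congr_fun hΛ0 ⟨_, monomial_mem_inverseSystemDeg (by omega) had ha⟩
          have h1 : Λ (monomial a 1) = multiFactorial a * coeff a (linearForm P * D) := by
            rw [hΛ, linearForm, Finset.sum_mul_sum, Finset.sum_comm, coeff_sum, Finset.mul_sum]
            refine Finset.sum_congr rfl fun b _ => ?_
            rw [eval_polyDeriv (isHomogeneous_monomial _ had) (hdeg b), coeff_sum,
              Finset.mul_sum, Finset.mul_sum]
            refine Finset.sum_congr rfl fun i _ => ?_
            rw [X, C_mul_monomial, monomial_mul, coeff_monomial, coeff_monomial, mul_one,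
              add_comm (Finsupp.single i 1)]
            by_cases h : a = b.1 + Finsupp.single i 1
            · rw [if_pos h, if_pos h.symm, ← h]; ring
            · rw [if_neg h, if_neg (Ne.symm h)]; ring
          rw [h1] at h0
          exact (mul_eq_zero.1 h0).resolve_left (Nat.cast_ne_zero.2 (multiFactorial_ne_zero _))
        · exact hLD.coeff_eq_zero had
      have hDC := eq_C_mul_X_pow_of_linearForm_mul hn hd hP hD hcoeff
      have hDb (b : MultiIndex (n + 1) (d - 1)) : coeff b.1 D = c b := by
        rw [coeff_sum, Finset.sum_eq_single b]
        · rw [coeff_monomial, if_pos rfl]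
        · intro b' _ h
          rw [coeff_monomial, if_neg fun h' => h (Subtype.ext h')]
        · simp
      refine Submodule.mem_span_singleton.2 ⟨c b₀, funext fun b => ?_⟩
      rw [← hDb b, hDC, X_pow_eq_monomial, C_mul_monomial, coeff_monomial, ← hDb b₀]
      by_cases h : b = b₀
      · subst h; simp [b₀]
      · rw [if_neg fun h' => h (Subtype.ext h'.symm)]
        simp [h]
    · rw [Submodule.span_le, Set.singleton_subset_iff, SetLike.mem_coe, LinearMap.mem_ker,
        Fintype.linearCombination_apply_single, one_smul]
      funext j
      -- The linear form `∂_0^(d-1) F_j` involves only the coefficients of `F_j` at `x_0^(d-1) x_i`,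
      -- and these vanish.
      rw [hu, eval_polyDeriv (hF j).1 (hdeg b₀)]
      refine Finset.sum_eq_zero fun i _ => ?_
      rw [(hF j).2 _ (Or.inr ⟨i, rfl⟩), mul_zero, mul_zero]
  have h1 := LinearMap.finrank_range_add_finrank_ker (Fintype.linearCombination K u)
  rw [hker, Fintype.range_linearCombination, Module.finrank_fintype_fun_eq_card, card_multiIndex,
    finrank_span_singleton (by simp)] at h1
  rw [h1]
  congr 1
  omega

/-! ### Osculating spaces along a lift of the parametrization -/

section Lift

variable {ι : Type*}

/-- Testing spans against functionals `w` turns a comparison of osculating spaces into one of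
vanishing conditions on the single form `∑ w_j F_j`. -/
theorem span_eq_span_of_orthogonal [Fintype ι] {A B : Set (ι → K)}
    (h : ∀ w : ι → K, (∀ x ∈ A, ∑ j, w j * x j = 0) ↔ ∀ x ∈ B, ∑ j, w j * x j = 0) :
    Submodule.span K A = Submodule.span K B := by
  classical
  rw [← Subspace.dualAnnihilator_inj]
  ext f
  have hf (x : ι → K) : f x = ∑ j, f (Pi.single j 1) * x j := by
    conv_lhs => rw [← Finset.univ_sum_single x, map_sum]
    refine Finset.sum_congr rfl fun j _ => ?_
    rw [show Pi.single j (x j) = x j • (Pi.single j 1 : ι → K) by rw [← Pi.single_smul]; simp,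
      map_smul, smul_eq_mul, mul_comm]
  have hS (S : Set (ι → K)) : f ∈ (Submodule.span K S).dualAnnihilator ↔
      ∀ x ∈ S, ∑ j, f (Pi.single j 1) * x j = 0 := by
    rw [Submodule.mem_dualAnnihilator]
    simp only [← hf]
    exact ⟨fun h x hx => h x (Submodule.subset_span hx), fun h x hx =>
      Submodule.span_le (p := LinearMap.ker f).2 h hx⟩
  rw [hS, hS, h]

theorem jetSpan_one {m : ℕ} (φ : ι → MvPowerSeries (Fin m) K) :
    jetSpan φ 1 = Submodule.span K (Set.range (frame φ)) := by
  rw [jetSpan]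
  congr 1
  ext w
  constructor
  · rintro ⟨a, ha, rfl⟩
    rcases Nat.eq_zero_or_pos a.degree with h | h
    · refine ⟨0, ?_⟩
      rw [(Finsupp.degree_eq_zero_iff a).1 h]
      funext j
      exact congrArg MvPowerSeries.constantCoeff (seriesDeriv_zero (φ j)).symm
    · obtain ⟨b, i, hb, rfl⟩ := exists_eq_add_single (show a.degree = 0 + 1 by omega)
      rw [(Finsupp.degree_eq_zero_iff b).1 hb]
      refine ⟨i.succ, funext fun j => ?_⟩
      refine Eq.trans ?_ (congrArg MvPowerSeries.constantCoeff
        (seriesDeriv_add_single 0 i (φ j)).symm)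
      rw [seriesDeriv_zero]
      rfl
  · rintro ⟨i, rfl⟩
    refine Fin.cases ?_ (fun i => ?_) i
    · exact ⟨0, by simp, funext fun j =>
        congrArg MvPowerSeries.constantCoeff (seriesDeriv_zero (φ j)).symm⟩
    · refine ⟨0 + Finsupp.single i 1, by simp, funext fun j => ?_⟩
      refine Eq.trans ?_ (congrArg MvPowerSeries.constantCoeff
        (seriesDeriv_add_single 0 i (φ j)).symm)
      rw [seriesDeriv_zero]
      rfl

/-- The differential at `P` of the polynomial map with components `F`. -/
def differential {m : ℕ} (F : ι → MvPolynomial (Fin m) K) (P : Fin m → K) :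
    (Fin m → K) →ₗ[K] (ι → K) :=
  LinearMap.pi fun j => ∑ k, eval P (pderiv k (F j)) • LinearMap.proj k

theorem differential_apply {m : ℕ} (F : ι → MvPolynomial (Fin m) K) (P v : Fin m → K) (j : ι) :
    differential F P v j = ∑ k, eval P (pderiv k (F j)) * v k := by
  simp [differential]

theorem differential_self {m d : ℕ} {F : ι → MvPolynomial (Fin m) K}
    (hF : ∀ j, (F j).IsHomogeneous d) (P : Fin m → K) :
    differential F P P = (d : K) • fun j => eval P (F j) := by
  funext j
  rw [differential_apply]
  have := euler_aeval (hF j) P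
  simpa [aeval_eq_eval] using this

variable {n d : ℕ} {F : ι → MvPolynomial (Fin (n + 1)) K} {φ : ι → MvPowerSeries (Fin n) K}
  {p : Fin (n + 1) → MvPowerSeries (Fin n) K} {g : MvPowerSeries (Fin n) K}

/-- Differentiating `g F(p)` gives a combination of `dF_P(∂_i p(0))` and `F(P)`; the latter is also
in the image, as `dF_P(P) = d F(P)` and `P` is the first frame vector. -/
theorem frame_mem_map_differential [CharZero K] (hd : d ≠ 0) (hF : ∀ j, (F j).IsHomogeneous d)
    (hφ : ∀ j, φ j = g * aeval p (F j)) (i : Fin (n + 1)) :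
    frame φ i ∈ (Submodule.span K (Set.range (frame p))).map
      (differential F fun k => MvPowerSeries.constantCoeff (p k)) := by
  set P := fun k => MvPowerSeries.constantCoeff (p k) with hPdef
  have hmem (i) : differential F P (frame p i) ∈
      (Submodule.span K (Set.range (frame p))).map (differential F P) :=
    ⟨_, Submodule.subset_span ⟨i, rfl⟩, rfl⟩
  have hP : (fun j => eval P (F j)) ∈
      (Submodule.span K (Set.range (frame p))).map (differential F P) := by
    have h := differential_self hF P
    have h' : (fun j => eval P (F j)) = (d : K)⁻¹ • differential F P (frame p 0) := by
      rw [show frame p 0 = P from rfl, h, smul_smul, inv_mul_cancel₀ (Nat.cast_ne_zero.2 hd),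
        one_smul]
    rw [h']
    exact Submodule.smul_mem _ _ (hmem 0)
  refine Fin.cases ?_ (fun i => ?_) i
  · have : frame φ 0 = MvPowerSeries.constantCoeff g • fun j => eval P (F j) := by
      funext j
      simp only [frame, Fin.cons_zero, hφ, map_mul, constantCoeff_aeval, Pi.smul_apply, smul_eq_mul, P]
    rw [this]
    exact Submodule.smul_mem _ _ hP
  · have : frame φ i.succ = MvPowerSeries.constantCoeff g • differential F P (frame p i.succ) +
        MvPowerSeries.constantCoeff (MvPowerSeries.pderiv K i g) • fun j => eval P (F j) := by
      funext j
      simp only [frame, Fin.cons_succ, hφ, Derivation.leibniz, derivation_aeval, smul_eq_mul,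
        map_add, map_mul, map_sum, constantCoeff_aeval, Pi.add_apply, Pi.smul_apply,
        differential_apply, P]
      ring
    rw [this]
    exact Submodule.add_mem _ (Submodule.smul_mem _ _ (hmem _)) (Submodule.smul_mem _ _ hP)

/-- The first jets of `φ` have rank `n + 1` and lie in the image of the span of the `n + 1` frame
vectors of `p`, which must then be independent. -/
theorem linearIndependent_frame [CharZero K] [Fintype ι] (hd : d ≠ 0)
    (hF : ∀ j, (F j).IsHomogeneous d) (hφ : ∀ j, φ j = g * aeval p (F j))
    (hrank : Module.finrank K (jetSpan φ 1) = n + 1) : LinearIndependent K (frame p) := by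
  rw [linearIndependent_iff_card_le_finrank_span, Fintype.card_fin]
  refine hrank.ge.trans ?_
  rw [jetSpan_one]
  refine le_trans (Submodule.finrank_mono (Submodule.span_le.2 ?_))
    (Submodule.finrank_map_le (differential F fun k => MvPowerSeries.constantCoeff (p k)) _)
  rintro _ ⟨i, rfl⟩
  exact frame_mem_map_differential hd hF hφ i

/-- A vector `w` is orthogonal to the left side iff `g G(p)` vanishes to order `d`, where `G = ∑ w_j
F_j`. The unit `g` is irrelevant, and `vanishesToOrder_aeval_iff` with `k = d - 1` translates this
into orthogonality to the right side. -/
theorem jetSpan_eq_span_derivVector [CharZero K] [Fintype ι] (hd : d ≠ 0)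
    (hF : ∀ j, (F j).IsHomogeneous d) (hg : IsUnit g) (hφ : ∀ j, φ j = g * aeval p (F j))
    (hp : LinearIndependent K (frame p)) :
    jetSpan φ (d - 1) = Submodule.span K (Set.range fun b : MultiIndex (n + 1) (d - 1) =>
      derivVector F (fun k => MvPowerSeries.constantCoeff (p k)) b) := by
  refine span_eq_span_of_orthogonal fun w => ?_
  have h1 : (∑ j, w j • φ j) = g * aeval p (∑ j, w j • F j) := by
    rw [map_sum, Finset.mul_sum]
    exact Finset.sum_congr rfl fun j _ => by rw [hφ, map_smul, mul_smul_comm]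
  have hG : (∑ j, w j • F j).IsHomogeneous d :=
    IsHomogeneous.sum _ _ _ fun j _ => by
      rw [smul_eq_C_mul]
      simpa using (isHomogeneous_C (Fin (n + 1)) (w j)).mul (hF j)
  have h2 := vanishesToOrder_aeval_iff (k := d - 1) hp hG (by omega)
  rw [← VanishesToOrder.mul_left_iff hg, ← h1] at h2
  have h3 (a : Fin n →₀ ℕ) : MvPowerSeries.constantCoeff (seriesDeriv a (∑ j, w j • φ j)) =
      ∑ j, w j * MvPowerSeries.constantCoeff (seriesDeriv a (φ j)) := by
    simp only [map_sum, map_smul, MvPowerSeries.constantCoeff_smul, smul_eq_mul]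
  have h4 (b : Fin (n + 1) →₀ ℕ) (P : Fin (n + 1) → K) :
      eval P (polyDeriv b (∑ j, w j • F j)) = ∑ j, w j * derivVector F P b j := by
    simp [map_sum, map_smul, derivVector]
  simp only [h4] at h2
  constructor
  · rintro h _ ⟨b, rfl⟩
    refine h2.1 (fun a ha => ?_) b.1 b.2
    rw [h3]
    exact h _ ⟨a, by omega, rfl⟩
  · rintro h _ ⟨a, ha, rfl⟩
    have := h2.2 (fun b hb => h _ ⟨⟨b, hb⟩, rfl⟩) a (by omega)
    rwa [h3] at this

end Lift

/-! ### Zariski closures -/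

theorem aeval_mul_of_isHomogeneous {ι A : Type*} [CommRing A] [Algebra K A] {k : ℕ}
    {G : MvPolynomial ι K} (hG : G.IsHomogeneous k) (c : A) (x : ι → A) :
    aeval (fun i => c * x i) G = c ^ k * aeval x G := by
  rw [aeval_def, aeval_def, eval₂_eq, eval₂_eq, Finset.mul_sum]
  refine Finset.sum_congr rfl fun a ha => ?_
  have hdeg : ∑ i ∈ a.support, a i = k := by
    by_contra h
    exact mem_support_iff.1 ha (hG.coeff_eq_zero h)
  simp only [mul_pow, Finset.prod_mul_distrib]
  rw [Finset.prod_pow_eq_pow_sum, hdeg]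
  ring

section Zariski

variable {ι : Type*}

theorem vanishesAt_mk {k : ℕ} {G : MvPolynomial ι K} (hG : G.IsHomogeneous k) {v : ι → K}
    (hv : v ≠ 0) : VanishesAt G (Projectivization.mk K v hv) ↔ eval v G = 0 := by
  obtain ⟨a, ha⟩ := Projectivization.exists_smul_eq_mk_rep K v hv
  rw [VanishesAt, ← ha]
  have := aeval_mul_of_isHomogeneous hG (a : K) v
  rw [aeval_eq_eval, aeval_eq_eval] at this
  change eval (fun i => (a : K) * v i) G = 0 ↔ _
  rw [this, mul_eq_zero, or_iff_right (pow_ne_zero _ a.ne_zero)]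

theorem mem_zariskiClosure_iff {T : Set (ℙ K (ι → K))} {x : ℙ K (ι → K)} :
    x ∈ zariskiClosure T ↔ ∀ G ∈ vanishingForms T, VanishesAt G x := by
  constructor
  · intro h G hG
    exact h {x | ∀ H ∈ ({G} : Set (MvPolynomial ι K)), VanishesAt H x}
      ⟨⟨_, by rintro _ rfl; exact hG.1, rfl⟩, by rintro y hy _ rfl; exact hG.2 y hy⟩ G rfl
  · rintro h _ ⟨⟨S, hS, rfl⟩, hT⟩ G hG
    exact h G ⟨hS G hG, fun y hy => hT hy G hG⟩

theorem subset_zariskiClosure (T : Set (ℙ K (ι → K))) : T ⊆ zariskiClosure T :=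
  fun _ hx => Set.mem_sInter.2 fun _ hZ => hZ.2 hx

theorem eq_zero_of_eval_torus [CharZero K] {m : ℕ} {H : MvPolynomial (Fin m) K}
    (h : ∀ P : Fin m → K, (∀ i, P i ≠ 0) → eval P H = 0) : H = 0 := by
  have : Infinite K := CharZero.infinite K
  refine funext_set (fun _ => {0}ᶜ) (fun _ => (Set.finite_singleton _).infinite_compl)
    fun P hP => ?_
  rw [map_zero]
  exact h P fun i => hP i (Set.mem_univ i)

theorem eval_aeval {m : ℕ} (F : ι → MvPolynomial (Fin m) K) (P : Fin m → K)
    (G : MvPolynomial ι K) : eval P (aeval F G) = eval (fun j => eval P (F j)) G := by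
  rw [← aeval_eq_eval, ← aeval_eq_eval, comp_aeval_apply]

theorem mem_vanishingForms_of_aeval_eq_zero {m : ℕ} {F : ι → MvPolynomial (Fin m) K} {k : ℕ}
    {G : MvPolynomial ι K} (hG : G.IsHomogeneous k) (h : aeval F G = 0) :
    G ∈ vanishingForms (imageVariety F) := by
  refine ⟨⟨k, hG⟩, fun x hx => mem_zariskiClosure_iff.1 hx G ⟨⟨k, hG⟩, ?_⟩⟩
  rintro _ ⟨P, hP, rfl⟩
  rw [vanishesAt_mk hG hP, ← eval_aeval, h, map_zero]

end Zariski

/-! ### Directional derivatives -/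

/-- The derivative of `H` at `y` in the direction `w`. -/
def dirDeriv {ι : Type*} [Fintype ι] (y w : ι → K) (H : MvPolynomial ι K) : K :=
  ∑ i, eval y (pderiv i H) * w i

section DirDeriv

variable {ι : Type*} [Fintype ι] (y w : ι → K)

theorem dirDeriv_sub (G H : MvPolynomial ι K) :
    dirDeriv y w (G - H) = dirDeriv y w G - dirDeriv y w H := by
  simp [dirDeriv, sub_mul]

theorem dirDeriv_mul (G H : MvPolynomial ι K) :
    dirDeriv y w (G * H) = dirDeriv y w G * eval y H + eval y G * dirDeriv y w H := by
  simp only [dirDeriv, Finset.sum_mul, Finset.mul_sum, ← Finset.sum_add_distrib]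
  refine Finset.sum_congr rfl fun i _ => ?_
  rw [pderiv_mul, map_add, map_mul, map_mul]
  ring

theorem dirDeriv_X (j : ι) : dirDeriv y w (X j) = w j := by
  classical
  simp [dirDeriv, pderiv_X, Pi.single_apply, apply_ite (eval y)]

theorem dirDeriv_aeval {τ : Type*} [Fintype τ] (F : τ → MvPolynomial ι K) (G : MvPolynomial τ K) :
    dirDeriv y w (aeval F G) =
      dirDeriv (fun j => eval y (F j)) (fun j => dirDeriv y w (F j)) G := by
  have h (H : MvPolynomial τ K) : eval y (aeval F H) = eval (fun j => eval y (F j)) H := by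
    rw [← aeval_eq_eval, ← aeval_eq_eval, comp_aeval_apply]
  simp only [dirDeriv, derivation_aeval, map_sum, map_mul, h, Finset.sum_mul, Finset.mul_sum]
  rw [Finset.sum_comm]
  exact Finset.sum_congr rfl fun j _ => Finset.sum_congr rfl fun i _ => by ring

theorem mem_tangentCone_iff {T : Set (ℙ K (ι → K))} :
    w ∈ tangentCone T y ↔ ∀ G ∈ vanishingForms T, dirDeriv y w G = 0 := by
  simp [tangentCone, dirDeriv]

end DirDeriv

theorem differential_eq_dirDeriv {ι : Type*} {m : ℕ} (F : ι → MvPolynomial (Fin m) K)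
    (P v : Fin m → K) : differential F P v = fun j => dirDeriv P v (F j) :=
  funext fun j => differential_apply F P v j

/-- Differentiating `G(φ) = 0` handles the derivative vectors; Euler's formula handles `φ(0)`. -/
theorem jetSpan_one_le_tangentCone {ι : Type*} [Fintype ι] {m : ℕ} {T : Set (ℙ K (ι → K))}
    {φ : ι → MvPowerSeries (Fin m) K} (h : ∀ G ∈ vanishingForms T, aeval φ G = 0) :
    jetSpan φ 1 ≤ tangentCone T fun j => MvPowerSeries.constantCoeff (φ j) := by
  rw [jetSpan_one, Submodule.span_le]
  rintro _ ⟨i, rfl⟩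
  refine (mem_tangentCone_iff _ _).2 fun G hG => ?_
  simp only [dirDeriv, ← constantCoeff_aeval]
  refine Fin.cases ?_ (fun i => ?_) i
  · obtain ⟨k, hk⟩ := hG.1
    have := congrArg MvPowerSeries.constantCoeff (euler_aeval hk φ)
    rw [h G hG, smul_zero, map_zero, map_sum] at this
    simpa [frame] using this
  · have := congrArg MvPowerSeries.constantCoeff
      (derivation_aeval (MvPowerSeries.pderiv K i) φ G)
    rw [h G hG, map_zero, map_zero, map_sum] at this
    simpa only [frame, Fin.cons_succ, map_mul] using this.symm

/-! ### Rational maps with a linear inverse on the torus -/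

/-- The forms `F j` of degree `d` define a rational map which is inverted, up to the factor `c`,
by the linear forms `ℓ i`; the factor `c` has no zeros on the torus. -/
structure HasLinearInverse {ι : Type*} {m : ℕ} (F : ι → MvPolynomial (Fin m) K) (d : ℕ)
    (c : MvPolynomial (Fin m) K) (ℓ : Fin m → MvPolynomial ι K) : Prop where
  isHomogeneous : ∀ j, (F j).IsHomogeneous d
  isHomogeneous_factor : c.IsHomogeneous (d - 1)
  isHomogeneous_inverse : ∀ i, (ℓ i).IsHomogeneous 1
  aeval_inverse : ∀ i, aeval F (ℓ i) = c * X i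
  eval_factor_ne_zero : ∀ P : Fin m → K, (∀ i, P i ≠ 0) → eval P c ≠ 0

namespace HasLinearInverse

variable {ι : Type*} {m d : ℕ} {F : ι → MvPolynomial (Fin m) K}
  {c : MvPolynomial (Fin m) K} {ℓ : Fin m → MvPolynomial ι K}

theorem eval_inverse (h : HasLinearInverse F d c ℓ) (P : Fin m → K) (i : Fin m) :
    eval (fun j => eval P (F j)) (ℓ i) = eval P c * P i := by
  rw [← eval_aeval, h.aeval_inverse, map_mul, eval_X]

theorem isHomogeneous_prod (h : HasLinearInverse F d c ℓ) :
    (∏ i, ℓ i).IsHomogeneous (∑ _i : Fin m, 1) :=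
  IsHomogeneous.prod _ _ _ fun i _ => h.isHomogeneous_inverse i

theorem eval_prod_ne_zero (h : HasLinearInverse F d c ℓ) {P : Fin m → K} (hP : ∀ i, P i ≠ 0) :
    eval (fun j => eval P (F j)) (∏ i, ℓ i) ≠ 0 := by
  rw [map_prod]
  refine Finset.prod_ne_zero_iff.2 fun i _ => ?_
  rw [h.eval_inverse]
  exact mul_ne_zero (h.eval_factor_ne_zero P hP) (hP i)

theorem eval_ne_zero [NeZero m] (h : HasLinearInverse F d c ℓ) {P : Fin m → K}
    (hP : ∀ i, P i ≠ 0) : (fun j => eval P (F j)) ≠ 0 := by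
  intro h0
  have h1 := h.eval_inverse P 0
  rw [h0] at h1
  -- Scaling by `0` shows that the linear form `ℓ 0` vanishes at the zero vector.
  have h2 := aeval_mul_of_isHomogeneous (h.isHomogeneous_inverse 0) (0 : K) (0 : ι → K)
  simp only [zero_mul, pow_one, aeval_eq_eval] at h2
  rw [show (0 : ι → K) = fun _ => 0 from rfl, h2] at h1
  exact mul_ne_zero (h.eval_factor_ne_zero P hP) (hP 0) h1.symm

/-- The complement of the image of the torus. -/
def boundary (ℓ : Fin m → MvPolynomial ι K) : Set (ℙ K (ι → K)) := {x | VanishesAt (∏ i, ℓ i) x}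

theorem isZariskiClosed_boundary (h : HasLinearInverse F d c ℓ) :
    IsZariskiClosed (boundary ℓ) :=
  ⟨{∏ i, ℓ i}, by rintro _ rfl; exact ⟨_, h.isHomogeneous_prod⟩, by simp [boundary]⟩

theorem mk_mem_diff_boundary [NeZero m] (h : HasLinearInverse F d c ℓ) {P : Fin m → K}
    (hP : ∀ i, P i ≠ 0) :
    Projectivization.mk K _ (h.eval_ne_zero hP) ∈ imageVariety F \ boundary ℓ :=
  ⟨subset_zariskiClosure _ ⟨P, h.eval_ne_zero hP, rfl⟩, fun hx =>
    h.eval_prod_ne_zero hP ((vanishesAt_mk h.isHomogeneous_prod _).1 hx)⟩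

/-- The torus maps into the complement of the boundary, and a polynomial vanishing on the torus is
zero. So a form vanishing off the boundary already vanishes on the whole variety, which gives
density. -/
theorem aeval_eq_zero [CharZero K] [NeZero m] (h : HasLinearInverse F d c ℓ)
    {G : MvPolynomial ι K} (hG : G ∈ vanishingForms (imageVariety F \ boundary ℓ)) :
    aeval F G = 0 := by
  refine eq_zero_of_eval_torus fun P hP => ?_
  obtain ⟨k, hk⟩ := hG.1
  rw [eval_aeval, ← vanishesAt_mk hk (h.eval_ne_zero hP)]
  exact hG.2 _ (h.mk_mem_diff_boundary hP)

theorem aeval_eq_zero_of_mem [CharZero K] [NeZero m] (h : HasLinearInverse F d c ℓ)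
    {G : MvPolynomial ι K} (hG : G ∈ vanishingForms (imageVariety F)) : aeval F G = 0 :=
  h.aeval_eq_zero ⟨hG.1, fun x hx => hG.2 x hx.1⟩

theorem subset_zariskiClosure_diff_boundary [CharZero K] [NeZero m]
    (h : HasLinearInverse F d c ℓ) :
    imageVariety F ⊆ zariskiClosure (imageVariety F \ boundary ℓ) := by
  refine fun x hx => mem_zariskiClosure_iff.2 fun G hG => ?_
  obtain ⟨k, hk⟩ := hG.1
  exact (mem_vanishingForms_of_aeval_eq_zero hk (h.aeval_eq_zero hG)).2 x hx

/-- Substituting `F` turns each `ℓ i` into `c x_i`; by homogeneity both terms become `c^d F_j`.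
These equations recover a point of the variety from its values under `ℓ`, and they carry the tangent
space and lifting arguments. -/
theorem relation_mem (h : HasLinearInverse F d c ℓ) (hd : 1 ≤ d) (j : ι) :
    X j * aeval ℓ c - aeval ℓ (F j) ∈ vanishingForms (imageVariety F) := by
  have h1 : (X j * aeval ℓ c : MvPolynomial ι K).IsHomogeneous d := by
    have := (isHomogeneous_X K j).mul (h.isHomogeneous_factor.aeval ℓ h.isHomogeneous_inverse)
    rwa [show 1 + 1 * (d - 1) = d by omega] at this
  have h2 : (aeval ℓ (F j)).IsHomogeneous d := by
    simpa using (h.isHomogeneous j).aeval ℓ h.isHomogeneous_inverse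
  refine mem_vanishingForms_of_aeval_eq_zero (h1.sub h2) ?_
  rw [map_sub, map_mul, aeval_X, comp_aeval_apply, comp_aeval_apply]
  simp only [h.aeval_inverse]
  rw [aeval_mul_of_isHomogeneous h.isHomogeneous_factor,
    aeval_mul_of_isHomogeneous (h.isHomogeneous j), aeval_X_left_apply, aeval_X_left_apply,
    ← pow_sub_one_mul (show d ≠ 0 by omega) c]
  ring

theorem eval_relation (h : HasLinearInverse F d c ℓ) (hd : 1 ≤ d) {x : ℙ K (ι → K)}
    (hx : x ∈ imageVariety F) (j : ι) :
    x.rep j * eval (fun i => eval x.rep (ℓ i)) c = eval (fun i => eval x.rep (ℓ i)) (F j) := by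
  have := (h.relation_mem hd j).2 x hx
  rw [VanishesAt, map_sub, map_mul, eval_X, ← aeval_eq_eval, comp_aeval_apply, comp_aeval_apply,
    sub_eq_zero] at this
  exact this

/-- Differentiating `ℓ_i(F) = c x_i` along a kernel vector `v` shows that `v` is a multiple of `P`;
but `dF_P(P) = d F(P)` is nonzero. -/
theorem differential_injective [Fintype ι] [CharZero K] [NeZero m] (h : HasLinearInverse F d c ℓ)
    (hd : 1 ≤ d) {P : Fin m → K} (hP : ∀ i, P i ≠ 0) :
    Function.Injective (differential F P) := by
  rw [← LinearMap.ker_eq_bot, LinearMap.ker_eq_bot']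
  intro v hv
  have hc := h.eval_factor_ne_zero P hP
  have hvP : v = (-(dirDeriv P v c / eval P c)) • P := by
    funext i
    have h1 := congrArg (dirDeriv P v) (h.aeval_inverse i)
    rw [dirDeriv_aeval, ← differential_eq_dirDeriv, hv, dirDeriv_mul, dirDeriv_X, eval_X] at h1
    rw [show dirDeriv _ (0 : ι → K) (ℓ i) = 0 by simp [dirDeriv]] at h1
    rw [Pi.smul_apply, smul_eq_mul]
    field_simp
    linear_combination -h1
  rw [hvP, map_smul, differential_self h.isHomogeneous, smul_smul, smul_eq_zero, mul_eq_zero] at hv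
  rcases hv with (hv | hv) | hv
  · rw [hvP, hv, zero_smul]
  · exact absurd hv (Nat.cast_ne_zero.2 (by omega))
  · exact absurd hv (h.eval_ne_zero hP)

theorem tangentCone_le [Fintype ι] [CharZero K] (h : HasLinearInverse F d c ℓ) (hd : 1 ≤ d)
    {y : ι → K} {P : Fin m → K} (hP : ∀ i, eval y (ℓ i) = P i) (hc : eval P c ≠ 0)
    (hy : ∀ j, y j * eval P c = eval P (F j)) :
    tangentCone (imageVariety F) y ≤ LinearMap.range (differential F P) := by
  intro w hw
  have hP' : (fun i => eval y (ℓ i)) = P := funext hP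
  set z : Fin m → K := fun i => dirDeriv y w (ℓ i) with hz
  have hdy : differential F P P = ((d : K) * eval P c) • y := by
    rw [differential_self h.isHomogeneous]
    funext j
    simp only [Pi.smul_apply, smul_eq_mul, ← hy]
    ring
  -- This is the derivative along `w` of the relations `y_j c(ℓ(y)) = F_j(ℓ(y))`.
  have hrel : eval P c • w + dirDeriv P z c • y = differential F P z := by
    funext j
    have h1 := (mem_tangentCone_iff _ _).1 hw _ (h.relation_mem hd j)
    rw [dirDeriv_sub, dirDeriv_mul, dirDeriv_aeval, dirDeriv_aeval, dirDeriv_X, eval_X,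
      ← aeval_eq_eval, comp_aeval_apply] at h1
    simp only [aeval_eq_eval, hP', ← hz] at h1
    rw [differential_eq_dirDeriv]
    simp only [Pi.add_apply, Pi.smul_apply, smul_eq_mul]
    linear_combination h1
  have hy' : y ∈ LinearMap.range (differential F P) := by
    refine ⟨((d : K) * eval P c)⁻¹ • P, ?_⟩
    rw [map_smul, hdy, smul_smul, inv_mul_cancel₀, one_smul]
    exact mul_ne_zero (Nat.cast_ne_zero.2 (by omega)) hc
  have hw' : eval P c • w ∈ LinearMap.range (differential F P) := by
    rw [eq_sub_of_add_eq hrel]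
    exact Submodule.sub_mem _ ⟨z, rfl⟩ (Submodule.smul_mem _ _ hy')
  exact (Submodule.smul_mem_iff _ hc).1 hw'

end HasLinearInverse

/-! ### Existence and lifting of local parametrizations -/

section Parametrization

variable {ι : Type*} {n d : ℕ} {F : ι → MvPolynomial (Fin (n + 1)) K}
  {c : MvPolynomial (Fin (n + 1)) K} {ℓ : Fin (n + 1) → MvPolynomial ι K}

/-- The affine chart `(P₀, P₁ + t₁, …, Pₙ + tₙ)` around `P`. -/
def affineChart (P : Fin (n + 1) → K) : Fin (n + 1) → MvPowerSeries (Fin n) K :=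
  Fin.cons (MvPowerSeries.C (P 0)) fun i => MvPowerSeries.C (P i.succ) + MvPowerSeries.X i

theorem constantCoeff_affineChart (P : Fin (n + 1) → K) :
    (fun k => MvPowerSeries.constantCoeff (affineChart P k)) = P := by
  funext k
  refine Fin.cases ?_ (fun i => ?_) k <;> simp [affineChart]

theorem frame_affineChart_succ (P : Fin (n + 1) → K) (i : Fin n) :
    frame (affineChart P) i.succ = Pi.single i.succ 1 := by
  classical
  funext k
  refine Fin.cases ?_ (fun j => ?_) k
  · simp [affineChart, frame]
  · by_cases hij : j = i
    · subst hij; simp [affineChart, frame]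
    · simp [affineChart, frame, MvPowerSeries.pderiv_X_of_ne hij, hij]

/-- As `P 0 ≠ 0`, the vectors `P, e_1, …, e_n` span the source, and up to nonzero scalars the frame
of the tuple consists of their images. The factor `κ` serves to match a prescribed representative of
the point. -/
theorem jetSpan_one_affineChart [CharZero K] (hd : 1 ≤ d) (hF : ∀ j, (F j).IsHomogeneous d)
    {P : Fin (n + 1) → K} (hP : P 0 ≠ 0) {κ : K} (hκ : κ ≠ 0) :
    jetSpan (fun j => MvPowerSeries.C κ * aeval (affineChart P) (F j)) 1 =
      LinearMap.range (differential F P) := by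
  set φ := fun j => MvPowerSeries.C κ * aeval (affineChart P) (F j)
  have hφ0 : frame φ 0 = (κ * (d : K)⁻¹) • differential F P P := by
    rw [differential_self hF, smul_smul, mul_assoc,
      inv_mul_cancel₀ (Nat.cast_ne_zero.2 (show d ≠ 0 by omega)), mul_one]
    funext j
    simp only [frame, Fin.cons_zero, φ, map_mul, constantCoeff_aeval, constantCoeff_affineChart,
      MvPowerSeries.constantCoeff_C, Pi.smul_apply, smul_eq_mul]
  have hφs (i : Fin n) : frame φ i.succ = κ • differential F P (Pi.single i.succ 1) := by
    funext j
    rw [Pi.smul_apply, smul_eq_mul, differential_apply, ← frame_affineChart_succ P]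
    simp only [frame, Fin.cons_succ, φ, Derivation.leibniz, derivation_aeval, smul_eq_mul,
      MvPowerSeries.pderiv_C, mul_zero, add_zero, map_mul, map_sum, constantCoeff_aeval,
      constantCoeff_affineChart, MvPowerSeries.constantCoeff_C]
  rw [jetSpan_one]
  apply le_antisymm
  · rw [Submodule.span_le]
    rintro _ ⟨i, rfl⟩
    refine Fin.cases ?_ (fun i => ?_) i
    · rw [hφ0]; exact Submodule.smul_mem _ _ ⟨_, rfl⟩
    · rw [hφs]; exact Submodule.smul_mem _ _ ⟨_, rfl⟩
  · set J := Submodule.span K (Set.range (frame φ))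
    have hs (i : Fin n) : differential F P (Pi.single i.succ 1) ∈ J := by
      rw [← Submodule.smul_mem_iff J hκ, ← hφs]
      exact Submodule.subset_span ⟨_, rfl⟩
    have hself : differential F P P ∈ J := by
      rw [← Submodule.smul_mem_iff J (mul_ne_zero hκ (inv_ne_zero (Nat.cast_ne_zero.2
        (show d ≠ 0 by omega)))), ← hφ0]
      exact Submodule.subset_span ⟨_, rfl⟩
    have hsum (v : Fin (n + 1) → K) : differential F P v =
        v 0 • differential F P (Pi.single 0 1) +
          ∑ i : Fin n, v i.succ • differential F P (Pi.single i.succ 1) := by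
      rw [← Fin.sum_univ_succ (fun i => v i • differential F P (Pi.single i 1))]
      simp only [← map_smul, ← map_sum]
      congr 1
      exact pi_eq_sum_univ' v
    have h0 : differential F P (Pi.single 0 1) ∈ J := by
      rw [← Submodule.smul_mem_iff J hP, ← add_sub_cancel_right (P 0 • _)
        (∑ i : Fin n, P i.succ • differential F P (Pi.single i.succ 1)), ← hsum P]
      exact Submodule.sub_mem _ hself
        (Submodule.sum_mem _ fun i _ => Submodule.smul_mem _ _ (hs i))
    rintro _ ⟨v, rfl⟩
    rw [hsum v]
    exact Submodule.add_mem _ (Submodule.smul_mem _ _ h0)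
      (Submodule.sum_mem _ fun i _ => Submodule.smul_mem _ _ (hs i))

namespace HasLinearInverse

theorem exists_isLocalParametrization [Fintype ι] [CharZero K] (h : HasLinearInverse F d c ℓ)
    (hd : 1 ≤ d) {x : ℙ K (ι → K)} (hx : x ∈ imageVariety F \ boundary ℓ) :
    ∃ φ : ι → MvPowerSeries (Fin n) K, IsLocalParametrization (imageVariety F) x φ := by
  set P : Fin (n + 1) → K := fun i => eval x.rep (ℓ i) with hPdef
  have hP : ∀ i, P i ≠ 0 := by
    have := hx.2
    rw [boundary, Set.mem_ofPred_eq, VanishesAt, map_prod] at this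
    exact fun i => Finset.prod_ne_zero_iff.1 this i (Finset.mem_univ i)
  have hc := h.eval_factor_ne_zero P hP
  have hrel := h.eval_relation hd hx.1
  rw [← hPdef] at hrel
  set φ : ι → MvPowerSeries (Fin n) K := fun j =>
    MvPowerSeries.C (eval P c)⁻¹ * aeval (affineChart P) (F j)
  have hφ : (fun j => MvPowerSeries.constantCoeff (φ j)) = x.rep := by
    funext j
    simp only [φ, map_mul, MvPowerSeries.constantCoeff_C, constantCoeff_aeval,
      constantCoeff_affineChart, ← hrel]
    field_simp
  have heq : ∀ G ∈ vanishingForms (imageVariety F), aeval φ G = 0 := by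
    intro G hG
    obtain ⟨k, hk⟩ := hG.1
    rw [aeval_mul_of_isHomogeneous hk, ← comp_aeval_apply, h.aeval_eq_zero_of_mem hG, map_zero,
      mul_zero]
  have hjet : jetSpan φ 1 = LinearMap.range (differential F P) :=
    jetSpan_one_affineChart hd h.isHomogeneous (hP 0) (inv_ne_zero hc)
  refine ⟨φ, hx.1, ⟨hφ ▸ x.rep_nonzero, ?_⟩, heq, ?_, ?_⟩
  · simp only [hφ, Projectivization.mk_rep]
  · refine le_antisymm (jetSpan_one_le_tangentCone heq) ?_
    rw [hφ, hjet]
    exact h.tangentCone_le hd (fun _ => rfl) hc hrel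
  · rw [hjet, LinearMap.finrank_range_of_inj (h.differential_injective hd hP),
      Module.finrank_fintype_fun_eq_card, Fintype.card_fin]

/-- The linear inverse lifts the parametrization: put `p = ℓ(φ)`. Off the boundary `c(p)` is a unit,
and the relations give `φ_j = c(p)⁻¹ F_j(p)`. -/
theorem exists_jetSpan_eq [Fintype ι] [CharZero K] (h : HasLinearInverse F d c ℓ)
    (hd : 1 ≤ d) {x : ℙ K (ι → K)} (hx : x ∉ boundary ℓ) {φ : ι → MvPowerSeries (Fin n) K}
    (hφ : IsLocalParametrization (imageVariety F) x φ) :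
    ∃ P : Fin (n + 1) → K, (∀ i, P i ≠ 0) ∧
      jetSpan φ (d - 1) = Submodule.span K (Set.range fun b : MultiIndex (n + 1) (d - 1) =>
        derivVector F P b) := by
  set p : Fin (n + 1) → MvPowerSeries (Fin n) K := fun i => aeval φ (ℓ i) with hp
  have hP : ∀ i, MvPowerSeries.constantCoeff (p i) ≠ 0 := by
    obtain ⟨h0, rfl⟩ := hφ.base
    rw [boundary, Set.mem_ofPred_eq, vanishesAt_mk h.isHomogeneous_prod, map_prod] at hx
    intro i
    rw [hp, constantCoeff_aeval]
    exact Finset.prod_ne_zero_iff.1 hx i (Finset.mem_univ i)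
  have hu : IsUnit (aeval p c) := by
    rw [MvPowerSeries.isUnit_iff_constantCoeff, constantCoeff_aeval, isUnit_iff_ne_zero]
    exact h.eval_factor_ne_zero _ hP
  obtain ⟨g, hg⟩ := hu.exists_left_inv
  have hrel (j : ι) : φ j = g * aeval p (F j) := by
    have := hφ.equations _ (h.relation_mem hd j)
    rw [map_sub, map_mul, aeval_X, comp_aeval_apply, comp_aeval_apply, sub_eq_zero] at this
    rw [← this, mul_left_comm, hg, mul_one]
  have hd0 : d ≠ 0 := by omega
  exact ⟨_, hP, jetSpan_eq_span_derivVector hd0 h.isHomogeneous (IsUnit.of_mul_eq_one _ hg) hrel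
    (linearIndependent_frame hd0 h.isHomogeneous hrel hφ.finrank_tangent)⟩

end HasLinearInverse

end Parametrization

/-! ### The Togliatti system -/

/-- Take `c = x_1^(d-2) x_2`. Each `c x_i` involves both `x_1` and `x_2`, so it is no pure power,
and its exponent at `x_0` is at most `1 < d - 1`; hence it lies in the inverse system. The form `ℓ
i` records its coordinates in the basis `F`. -/
theorem exists_hasLinearInverse [CharZero K] {n d : ℕ} (hn : 2 ≤ n) (hd : 3 ≤ d) {ι : Type*}
    [Fintype ι] (F : Module.Basis ι K (inverseSystemDeg (togliattiIdeal K n d) d)) :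
    ∃ c ℓ, HasLinearInverse (fun j => (F j : MvPolynomial (Fin (n + 1)) K)) d c ℓ := by
  let i₁ : Fin (n + 1) := ⟨1, by omega⟩
  let i₂ : Fin (n + 1) := ⟨2, by omega⟩
  have h12 : i₁ ≠ i₂ := by simp [i₁, i₂]
  have h01 : i₁ ≠ 0 := by simp [i₁, Fin.ext_iff]
  have h02 : i₂ ≠ 0 := by simp [i₂, Fin.ext_iff]
  let e : Fin (n + 1) →₀ ℕ := Finsupp.single i₁ (d - 2) + Finsupp.single i₂ 1
  have he : e.degree = d - 1 := by
    rw [map_add, Finsupp.degree_single, Finsupp.degree_single]; omega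
  have he1 : e i₁ ≠ 0 := by simp [e]; omega
  have he2 : e i₂ ≠ 0 := by simp [e]
  have he0 : e 0 = 0 := by simp [e, h01, h02]
  have hmem (i) : monomial (e + Finsupp.single i 1) (1 : K) ∈
      inverseSystemDeg (togliattiIdeal K n d) d := by
    refine monomial_mem_inverseSystemDeg (by omega) ?_ ?_
    · rw [map_add, he, Finsupp.degree_single]; omega
    · rintro (⟨k, hk⟩ | ⟨k, hk⟩)
      · have h1 := DFunLike.congr_fun hk i₁
        have h2 := DFunLike.congr_fun hk i₂
        simp only [Finsupp.add_apply, Finsupp.single_apply] at h1 h2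
        split_ifs at h1 h2 <;> omega
      · have h0 := DFunLike.congr_fun hk 0
        simp only [Finsupp.add_apply, Finsupp.single_apply, he0] at h0
        split_ifs at h0 <;> omega
  let G (i) : inverseSystemDeg (togliattiIdeal K n d) d := ⟨_, hmem i⟩
  refine ⟨monomial e 1, fun i => ∑ j, C (F.repr (G i) j) * X j,
    fun j => ((mem_inverseSystemDeg_iff (by omega)).1 (F j).2).1, isHomogeneous_monomial _ he,
    fun i => IsHomogeneous.sum _ _ _ fun j _ => isHomogeneous_C_mul_X _ _, fun i => ?_,
    fun P hP => ?_⟩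
  · have h1 := congrArg Subtype.val (F.sum_repr (G i))
    rw [Submodule.coe_sum] at h1
    rw [X, monomial_mul, one_mul, map_sum]
    refine Eq.trans (Finset.sum_congr rfl fun j _ => ?_) h1
    rw [map_mul, aeval_C, aeval_X, Submodule.coe_smul, algebraMap_eq, smul_eq_C_mul]
  · rw [eval_monomial, one_mul]
    exact Finset.prod_ne_zero_iff.2 fun i _ => pow_ne_zero _ (hP i)

theorem satisfiesLaplaceEquations_togliatti [CharZero K] {n d : ℕ} (hn : 3 ≤ n) (hd : 3 ≤ d)
    {ι : Type*} [Fintype ι]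
    (F : Module.Basis ι K (inverseSystemDeg (togliattiIdeal K n d) d)) :
    SatisfiesLaplaceEquations
      (imageVariety fun j => (F j : MvPolynomial (Fin (n + 1)) K)) n (d - 1) 1 := by
  obtain ⟨c, ℓ, h⟩ := exists_hasLinearInverse (by omega) hd F
  -- The image of the torus point `(1, …, 1)` shows that the variety is nonempty.
  refine ⟨⟨_, (h.mk_mem_diff_boundary (P := 1) (by simp)).1⟩, HasLinearInverse.boundary ℓ,
    h.isZariskiClosed_boundary, h.subset_zariskiClosure_diff_boundary, fun x hx =>
    ⟨h.exists_isLocalParametrization (by omega) hx, fun φ hφ => ?_⟩⟩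
  obtain ⟨P, hP, hjet⟩ := h.exists_jetSpan_eq (by omega) hx.2 hφ
  have := finrank_span_derivVector hn (by omega) F hP
  rw [← hjet] at this
  rw [osculatingDim, ← this]
  push_cast
  ring

end Osculating
end

theorem mainTheorem9 (K : Type*) [Field K] [IsAlgClosed K] [CharZero K]
    (n d : ℕ) (hn : 4 ≤ n) (hd : 4 ≤ d) :
    (∀ (N : ℕ) (F : Module.Basis (Fin N) K
        (Osculating.inverseSystemDeg (Osculating.togliattiIdeal K n d) d)),
      Osculating.SatisfiesLaplaceEquations
        (Osculating.imageVariety fun j => (F j : MvPolynomial (Fin (n + 1)) K)) n (d - 1) 1) ∧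
    LinearMap.ker (Osculating.mulMap (Osculating.togliattiIdeal K n d)
        (Osculating.sumForm_isHomogeneous K (n + 1)) (Nat.sub_add_cancel (by omega : 1 ≤ d))) =
      Submodule.span K
        {⟨Ideal.Quotient.mk (Osculating.togliattiIdeal K n d) (MvPolynomial.X 0 ^ (d - 1)),
          Osculating.mk_mem_gradedPiece _ (MvPolynomial.isHomogeneous_X_pow 0 (d - 1))⟩} ∧
    Ideal.Quotient.mk (Osculating.togliattiIdeal K n d) (MvPolynomial.X 0 ^ (d - 1)) ≠ 0 := by
  refine ⟨fun N F => Osculating.satisfiesLaplaceEquations_togliatti (by omega) (by omega) F,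
    Osculating.ker_mulMap_togliattiIdeal (by omega) (by omega) _, fun h0 => ?_⟩
  exact Osculating.X_zero_pow_notMem_togliattiIdeal (by omega) (Ideal.Quotient.eq_zero_iff_mem.1 h0)
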